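/- **Theorem.** Let $\mathbb K=\mathbb R$ or $\mathbb C$, let $n\ge 1$, and let $\beta$ be a finitely generated s-tensor norm of order $n$ on the class of Banach spaces over $\mathbb K$. Then $\beta$ has an injective hull $/\beta\backslash$ (a greatest injective s-tensor norm $\le\beta$) and a projective hull $\backslash\beta/$ (a least projective s-tensor norm $\ge\beta$), and $$\mathcal Q_{/\beta\backslash}\overset{1}{=}\mathcal Q_\beta\circ\mathcal L_\infty,\qquad \mathcal Q_{\backslash\beta/}\overset{1}{=}\mathcal Q_\beta\circ(\mathcal L_1)^{-1},$$ where $\overset1=$ means that both sides consist of the same continuous $n$-homogeneous polynomials on every Banach space, with the same norms. Here the following conventions are used. * $\otimes^{n,s}E$ is the linear span of the tensors $\otimes^n x=x\otimes\cdots\otimes x$ in $\otimes^nE$; $\varepsilon_{n,s}(z)=\sup\{|\langle\otimes^n x',z\rangle|:x'\in B_{E'}\}$ and $\pi_{n,s}(z)=\inf\{\sum_j|\lambda_j|\|x_j\|^n: z=\sum_j\lambda_j\otimes^nx_j\}$ (finite sums). * A finitely generated s-tensor norm $\beta$ of order $n$ assigns to every Banach space $E$ a norm $\beta(\cdot\,;E)$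 on $\otimes^{n,s}E$ such that $\varepsilon_{n,s}\le\beta\le\pi_{n,s}$, $\beta(\otimes^nT\,z;F)\le\|T\|^n\beta(z;E)$ for all bounded operators $T:E\to F$, and $\beta(z;E)=\inf\beta(z;M)$ over all finite dimensional subspaces $M\subset E$ with $z\in\otimes^{n,s}M$. In this statement "s-tensor norm" always means finitely generated s-tensor norm. * $\beta$ is injective if $\otimes^nI:(\otimes^{n,s}E,\beta)\to(\otimes^{n,s}F,\beta)$ is an isometry for every linear isometry (into) $I:E\to F$, and projective if $\otimes^nQ$ is a metric surjection for $\beta$ for every metric surjection $Q:E\to F$ (a surjection such that $\|y\|=\inf\{\|x\|:Qx=y\}$ for all $y$). For s-tensor norms, $\beta\le\gamma$ means $\beta(z;E)\le\gamma(z;E)$ for all $E$ and $z$. * $\mathcal Q_\beta(E)=(\otimes^{n,s}_\beta E)'$: the polynomials $p(x)=\varphi(\otimes^nx)$ with $\varphi$ a $\beta$-continuous linear functional on $\otimes^{n,s}E$, and $\|p\|_{\mathcal Q_\beta}$ is the dual norm of $\varphi$. * For $p\in\{1,\infty\}$, $\mathcal L_p$ is the ideal of operators $T:E\to F$ for which there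 are a measure $\mu$ and bounded operators $R:E\to L_p(\mu)$, $S:L_p(\mu)\to F''$ with $J_F T=SR$, where $J_F:F\to F''$ is the canonical embedding; $\|T\|_{\mathcal L_p}=\inf\|S\|\,\|R\|$. * For an operator ideal $\mathfrak A$, $p\in\mathcal Q\circ\mathfrak A(E)$ if $p=q\circ T$ with $F$ a Banach space, $T\in\mathfrak A(E,F)$ and $q\in\mathcal Q(F)$, and $\|p\|_{\mathcal Q\circ\mathfrak A}=\inf\|q\|_{\mathcal Q}\|T\|_{\mathfrak A}^n$ over all such factorizations. Further, $p\in\mathcal Q\circ\mathfrak A^{-1}(E)$ if $\|p\|_{\mathcal Q\circ\mathfrak A^{-1}}=\sup\{\|p\circ T\|_{\mathcal Q}: F \text{ Banach},\ T\in\mathfrak A(F,E),\ \|T\|_{\mathfrak A}\le1\}<\infty$, where $\|p\circ T\|_{\mathcal Q}=\infty$ if $p\circ T\notin\mathcal Q(F)$. -/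

import Mathlib

set_option maxSynthPendingDepth 3

open scoped ENNReal NNReal TensorProduct

universe u

noncomputable section

namespace SymTensorNorms

/-! ### Symmetric tensor products -/

section Tensors

variable (𝕜 : Type) [RCLike 𝕜] (n : ℕ)

/-- The `n`-fold symmetric tensor product of `E`: the linear span of the powers `x ⊗ ⋯ ⊗ x` in the
full `n`-fold tensor product. -/
def symTensor (E : Type u) [AddCommGroup E] [Module 𝕜 E] :
    Submodule 𝕜 (⨂[𝕜] _ : Fin n, E) :=
  Submodule.span 𝕜 (Set.range fun x : E => PiTensorProduct.tprod 𝕜 fun _ : Fin n => x)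

/-- The elementary symmetric tensor `⊗ⁿ x`. -/
def symPow {E : Type u} [AddCommGroup E] [Module 𝕜 E] (x : E) : symTensor 𝕜 n E :=
  ⟨PiTensorProduct.tprod 𝕜 fun _ : Fin n => x, Submodule.subset_span ⟨x, rfl⟩⟩

variable {𝕜}

theorem map_mem_symTensor {E F : Type u} [AddCommGroup E] [Module 𝕜 E] [AddCommGroup F]
    [Module 𝕜 F] (T : E →ₗ[𝕜] F) (z : ⨂[𝕜] _ : Fin n, E) (hz : z ∈ symTensor 𝕜 n E) :
    PiTensorProduct.map (fun _ : Fin n => T) z ∈ symTensor 𝕜 n F := by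
  have h : symTensor 𝕜 n E ≤
      (symTensor 𝕜 n F).comap (PiTensorProduct.map (fun _ : Fin n => T)) := by
    refine Submodule.span_le.2 ?_
    rintro _ ⟨x, rfl⟩
    have h2 := PiTensorProduct.map_tprod (R := 𝕜) (fun _ : Fin n => T) (fun _ : Fin n => x)
    refine Submodule.mem_comap.2 ?_
    rw [h2]
    exact Submodule.subset_span ⟨T x, rfl⟩
  exact h hz

/-- The map `⊗ⁿ T` between symmetric tensor products induced by a linear map `T`. -/
def symMap {E F : Type u} [AddCommGroup E] [Module 𝕜 E] [AddCommGroup F] [Module 𝕜 F]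
    (T : E →ₗ[𝕜] F) : symTensor 𝕜 n E →ₗ[𝕜] symTensor 𝕜 n F :=
  (PiTensorProduct.map (fun _ : Fin n => T)).restrict (map_mem_symTensor n T)

/-- The linear functional on the symmetric tensor product which sends `⊗ⁿ x` to `(φ x) ^ n`. -/
def powFunctional {E : Type u} [AddCommGroup E] [Module 𝕜 E] (φ : E →ₗ[𝕜] 𝕜) :
    symTensor 𝕜 n E →ₗ[𝕜] 𝕜 :=
  (PiTensorProduct.lift
    ((MultilinearMap.mkPiAlgebra 𝕜 (Fin n) 𝕜).compLinearMap fun _ : Fin n => φ)).domRestrict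
    (symTensor 𝕜 n E)

theorem symMap_symPow {E F : Type u} [AddCommGroup E] [Module 𝕜 E] [AddCommGroup F] [Module 𝕜 F]
    (T : E →ₗ[𝕜] F) (x : E) : symMap n T (symPow 𝕜 n x) = symPow 𝕜 n (T x) := by
  apply Subtype.ext
  simp [symMap, symPow, LinearMap.restrict_apply]

theorem powFunctional_symPow {E : Type u} [AddCommGroup E] [Module 𝕜 E] (φ : E →ₗ[𝕜] 𝕜) (x : E) :
    powFunctional n φ (symPow 𝕜 n x) = φ x ^ n := by
  simp [powFunctional, symPow]

/-- The injective symmetric tensor norm `ε_{n,s}`: the supremum of `|⟨⊗ⁿ φ, z⟩|` over all `φ` in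
the unit ball of the dual space. -/
def epsNorm {E : Type u} [NormedAddCommGroup E] [NormedSpace 𝕜 E] (z : symTensor 𝕜 n E) : ℝ :=
  sSup {r : ℝ | ∃ φ : StrongDual 𝕜 E, ‖φ‖ ≤ 1 ∧ r = ‖powFunctional n φ.toLinearMap z‖}

/-- The projective symmetric tensor norm `π_{n,s}`: the infimum of `∑ |c_j| ‖x_j‖ⁿ` over all
finite representations `z = ∑ c_j ⊗ⁿ x_j`. -/
def piNorm {E : Type u} [NormedAddCommGroup E] [NormedSpace 𝕜 E] (z : symTensor 𝕜 n E) : ℝ :=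
  sInf {r : ℝ | ∃ (m : ℕ) (c : Fin m → 𝕜) (x : Fin m → E),
    z = ∑ j, c j • symPow 𝕜 n (x j) ∧ r = ∑ j, ‖c j‖ * ‖x j‖ ^ n}

end Tensors

/-! ### s-tensor norms, and their injective and projective hulls -/

/-- A (finitely generated) s-tensor norm of order `n` on the class of all Banach spaces over `𝕜`
(in a universe `u`). -/
structure STensorNorm (𝕜 : Type) [RCLike 𝕜] (n : ℕ) where
  /-- the norm on the `n`-fold symmetric tensor product of `E` -/
  norm : ∀ (E : Type u) [NormedAddCommGroup E] [NormedSpace 𝕜 E] [CompleteSpace E],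
    Seminorm 𝕜 (symTensor 𝕜 n E)
  eq_zero_of_norm_eq_zero : ∀ (E : Type u) [NormedAddCommGroup E] [NormedSpace 𝕜 E]
    [CompleteSpace E] (z : symTensor 𝕜 n E), norm E z = 0 → z = 0
  eps_le : ∀ (E : Type u) [NormedAddCommGroup E] [NormedSpace 𝕜 E] [CompleteSpace E]
    (z : symTensor 𝕜 n E), epsNorm n z ≤ norm E z
  le_pi : ∀ (E : Type u) [NormedAddCommGroup E] [NormedSpace 𝕜 E] [CompleteSpace E]
    (z : symTensor 𝕜 n E), norm E z ≤ piNorm n z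
  /-- the metric mapping property -/
  map_le : ∀ (E F : Type u) [NormedAddCommGroup E] [NormedSpace 𝕜 E] [CompleteSpace E]
    [NormedAddCommGroup F] [NormedSpace 𝕜 F] [CompleteSpace F] (T : E →L[𝕜] F)
    (z : symTensor 𝕜 n E), norm F (symMap n T.toLinearMap z) ≤ ‖T‖ ^ n * norm E z
  /-- the norm of `z` is the infimum of its norms over the finite dimensional subspaces `M` of `E`
  with `z ∈ ⊗^{n,s} M` -/
  finitelyGenerated : ∀ (E : Type u) [NormedAddCommGroup E] [NormedSpace 𝕜 E] [CompleteSpace E]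
    (z : symTensor 𝕜 n E),
    IsGLB {r : ℝ | ∃ (M : Submodule 𝕜 E) (_ : FiniteDimensional 𝕜 M) (_ : CompleteSpace M)
      (w : symTensor 𝕜 n M), symMap n M.subtype w = z ∧ r = norm M w} (norm E z)

/-- `Q : E → F` is a metric surjection: it is onto and the norm of `F` is the quotient norm. -/
def IsMetricSurjection {𝕜 : Type} [RCLike 𝕜] {E F : Type u} [NormedAddCommGroup E]
    [NormedSpace 𝕜 E] [NormedAddCommGroup F] [NormedSpace 𝕜 F] (Q : E →L[𝕜] F) : Prop :=
  Function.Surjective Q ∧ ∀ y : F, IsGLB {r : ℝ | ∃ x : E, Q x = y ∧ r = ‖x‖} ‖y‖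

namespace STensorNorm

variable {𝕜 : Type} [RCLike 𝕜] {n : ℕ}

instance : LE (STensorNorm.{u} 𝕜 n) where
  le β γ := ∀ (E : Type u) [NormedAddCommGroup E] [NormedSpace 𝕜 E] [CompleteSpace E]
    (z : symTensor 𝕜 n E), β.norm E z ≤ γ.norm E z

/-- `β` is injective: `⊗ⁿ I` is an isometry for `β` whenever `I` is a linear isometry (into). -/
def IsInjective (β : STensorNorm.{u} 𝕜 n) : Prop :=
  ∀ (E F : Type u) [NormedAddCommGroup E] [NormedSpace 𝕜 E] [CompleteSpace E]
    [NormedAddCommGroup F] [NormedSpace 𝕜 F] [CompleteSpace F] (I : E →ₗᵢ[𝕜] F)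
    (z : symTensor 𝕜 n E), β.norm F (symMap n I.toLinearMap z) = β.norm E z

/-- `β` is projective: `⊗ⁿ Q` is a metric surjection for `β` whenever `Q` is one. -/
def IsProjective (β : STensorNorm.{u} 𝕜 n) : Prop :=
  ∀ (E F : Type u) [NormedAddCommGroup E] [NormedSpace 𝕜 E] [CompleteSpace E]
    [NormedAddCommGroup F] [NormedSpace 𝕜 F] [CompleteSpace F] (Q : E →L[𝕜] F),
    IsMetricSurjection Q →
      Function.Surjective (symMap n Q.toLinearMap) ∧
      ∀ z : symTensor 𝕜 n F,
        IsGLB {r : ℝ | ∃ w : symTensor 𝕜 n E, symMap n Q.toLinearMap w = z ∧ r = β.norm E w}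
          (β.norm F z)

/-- `γ` is the injective hull of `β`: the greatest injective s-tensor norm below `β`. -/
def IsInjectiveHull (β γ : STensorNorm.{u} 𝕜 n) : Prop :=
  IsGreatest {δ : STensorNorm.{u} 𝕜 n | δ.IsInjective ∧ δ ≤ β} γ

/-- `γ` is the projective hull of `β`: the least projective s-tensor norm above `β`. -/
def IsProjectiveHull (β γ : STensorNorm.{u} 𝕜 n) : Prop :=
  IsLeast {δ : STensorNorm.{u} 𝕜 n | δ.IsProjective ∧ β ≤ δ} γ

end STensorNorm

/-! ### Homogeneous polynomials, polynomial ideals and operator ideals -/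

/-- Continuous scalar valued `n`-homogeneous polynomials on `E`. -/
def HomPoly (𝕜 : Type) [RCLike 𝕜] (n : ℕ) (E : Type u) [NormedAddCommGroup E]
    [NormedSpace 𝕜 E] : Type u :=
  {p : E → 𝕜 // ∃ A : ContinuousMultilinearMap 𝕜 (fun _ : Fin n => E) 𝕜,
    ∀ x, p x = A fun _ => x}

/-- The composition `q ∘ T` of a polynomial with a continuous linear operator. -/
def HomPoly.comp {𝕜 : Type} [RCLike 𝕜] {n : ℕ} {E F : Type u} [NormedAddCommGroup E]
    [NormedSpace 𝕜 E] [NormedAddCommGroup F] [NormedSpace 𝕜 F] (q : HomPoly 𝕜 n F)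
    (T : E →L[𝕜] F) : HomPoly 𝕜 n E :=
  ⟨fun x => q.1 (T x), by
    obtain ⟨A, hA⟩ := q.2
    exact ⟨A.compContinuousLinearMap fun _ => T, fun x => by simp [hA]⟩⟩

/-- A class of `n`-homogeneous polynomials with a norm, recorded by the `[0, ∞]`-valued extension
of the norm which is `∞` exactly outside the class. -/
structure PolyClass (𝕜 : Type) [RCLike 𝕜] (n : ℕ) where
  norm : ∀ (E : Type u) [NormedAddCommGroup E] [NormedSpace 𝕜 E] [CompleteSpace E],
    HomPoly 𝕜 n E → ℝ≥0∞

/-- A class of continuous linear operators between Banach spaces with a norm, recorded by the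
`[0, ∞]`-valued extension of the norm which is `∞` exactly outside the class. -/
structure OpClass (𝕜 : Type) [RCLike 𝕜] where
  norm : ∀ (E F : Type u) [NormedAddCommGroup E] [NormedSpace 𝕜 E] [CompleteSpace E]
    [NormedAddCommGroup F] [NormedSpace 𝕜 F] [CompleteSpace F], (E →L[𝕜] F) → ℝ≥0∞

namespace OpClass

variable {𝕜 : Type} [RCLike 𝕜]

/-- `T` belongs to the class. -/
def Mem (𝔄 : OpClass.{u} 𝕜) {E F : Type u} [NormedAddCommGroup E] [NormedSpace 𝕜 E]
    [CompleteSpace E] [NormedAddCommGroup F] [NormedSpace 𝕜 F] [CompleteSpace F]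
    (T : E →L[𝕜] F) : Prop :=
  𝔄.norm E F T < ∞

variable (𝕜)

/-- The ideal `𝓛_p` of `p`-factorable operators: `T : E → F` belongs to it if `J_F ∘ T = S ∘ R`
with `R : E → L_p(μ)` and `S : L_p(μ) → F''` for some measure `μ`, where `J_F : F → F''` is the
canonical embedding; the norm is the infimum of `‖S‖ ‖R‖` over all such factorizations. -/
def factorable (p : ℝ≥0∞) [Fact (1 ≤ p)] : OpClass.{u} 𝕜 where
  norm E F _ _ _ _ _ _ T :=
    sInf {r : ℝ≥0∞ | ∃ (Ω : Type u) (_ : MeasurableSpace Ω) (μ : MeasureTheory.Measure Ω)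
      (R : E →L[𝕜] MeasureTheory.Lp 𝕜 p μ)
      (S : MeasureTheory.Lp 𝕜 p μ →L[𝕜] StrongDual 𝕜 (StrongDual 𝕜 F)),
      (∀ x : E, S (R x) = NormedSpace.inclusionInDoubleDual 𝕜 F (T x)) ∧ r = ‖S‖ₑ * ‖R‖ₑ}

end OpClass

namespace PolyClass

variable {𝕜 : Type} [RCLike 𝕜] {n : ℕ}

/-- `p` belongs to the class. -/
def Mem (𝒬 : PolyClass.{u} 𝕜 n) {E : Type u} [NormedAddCommGroup E] [NormedSpace 𝕜 E]
    [CompleteSpace E] (p : HomPoly 𝕜 n E) : Prop :=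
  𝒬.norm E p < ∞

/-- Isometric equality: the two classes have the same members on every Banach space, with the same
norms. -/
def IsometricEq (𝒬 ℛ : PolyClass.{u} 𝕜 n) : Prop :=
  ∀ (E : Type u) [NormedAddCommGroup E] [NormedSpace 𝕜 E] [CompleteSpace E] (p : HomPoly 𝕜 n E),
    (𝒬.Mem p ↔ ℛ.Mem p) ∧ 𝒬.norm E p = ℛ.norm E p

/-- The ideal `𝒬_β` of `β`-continuous polynomials: those `p` for which there is a `β`-continuous
linear functional `φ` on the symmetric tensor product with `p x = φ (⊗ⁿ x)`; the norm of `p` is the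
norm of this (unique) functional in the dual space of `(⊗^{n,s} E, β)`. -/
def ofTensorNorm (β : STensorNorm.{u} 𝕜 n) : PolyClass.{u} 𝕜 n where
  norm E _ _ _ p :=
    sInf {r : ℝ≥0∞ | ∃ (φ : symTensor 𝕜 n E →ₗ[𝕜] 𝕜) (C : ℝ≥0),
      (∀ x : E, φ (symPow 𝕜 n x) = p.1 x) ∧ (∀ z, ‖φ z‖ ≤ C * β.norm E z) ∧ r = C}

/-- The composition ideal `𝒬 ∘ 𝔄`: polynomials `p = q ∘ T` with `T ∈ 𝔄(E, F)` and `q ∈ 𝒬(F)` for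
some Banach space `F`; the norm is the infimum of `‖q‖ ‖T‖ⁿ` over all such factorizations. -/
def comp (𝒬 : PolyClass.{u} 𝕜 n) (𝔄 : OpClass.{u} 𝕜) : PolyClass.{u} 𝕜 n where
  norm E _ _ _ p :=
    sInf {r : ℝ≥0∞ | ∃ (F : Type u) (_ : NormedAddCommGroup F) (_ : NormedSpace 𝕜 F)
      (_ : CompleteSpace F) (T : E →L[𝕜] F) (q : HomPoly 𝕜 n F),
      𝔄.Mem T ∧ 𝒬.Mem q ∧ p = q.comp T ∧ r = 𝒬.norm F q * 𝔄.norm E F T ^ n}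

/-- The quotient ideal `𝒬 ∘ 𝔄⁻¹`: the norm of `p` is the supremum (in `[0, ∞]`) of `‖p ∘ T‖_𝒬` over
all Banach spaces `F` and all `T ∈ 𝔄(F, E)` of norm at most one, and `p` belongs to the ideal if this
is finite. -/
def compInv (𝒬 : PolyClass.{u} 𝕜 n) (𝔄 : OpClass.{u} 𝕜) : PolyClass.{u} 𝕜 n where
  norm E _ _ _ p :=
    sSup {r : ℝ≥0∞ | ∃ (F : Type u) (_ : NormedAddCommGroup F) (_ : NormedSpace 𝕜 F)
      (_ : CompleteSpace F) (T : F →L[𝕜] E), 𝔄.norm F E T ≤ 1 ∧ r = 𝒬.norm F (p.comp T)}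

end PolyClass

end SymTensorNorms

end

/-!
The hulls are constructed explicitly, and both polynomial identities rest on one approximation
argument.

Injective hull. Put `γ(z; E) = β(⊗ⁿ I z; ℓ_∞(B_{E'}))` for the canonical embedding `I` of `E`
(`injHull`). Since `ℓ_∞(S)` has the metric extension property (Hahn–Banach in each coordinate),
`γ` does not depend on the embedding, hence it is injective, and a norm which is preserved by
isometries is automatically finitely generated. It is the greatest such norm, because an injective
norm is determined by its values on the spaces `ℓ_∞`.

Projective hull. Let `γ(z; E)` be the infimum of `β(w; ℓ_1^ι)` over all `z = ⊗ⁿ V w` with `ι` finite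
and `‖V : ℓ_1^ι → E‖ ≤ 1` (`projHull`). It is finitely generated because `V` has finite rank, and
projective because operators on `ℓ_1^ι` lift along metric surjections. It is the least such norm:
every `E` is a metric quotient of some `ℓ_1(S)`, where `γ ≤ β` (`projHullFun_lp_one_le`).

The identities for polynomials. A functional bounded for an s-tensor norm is the linearization of a
continuous polynomial, by polarization (`exists_homPoly`); hence it is enough to control it after
replacing an operator `T` by operators which approximate `T` on finite sets
(`HomPoly.norm_functional_symMap_le`). If `J T = S R` factors through `L_p(μ)` with `p ∈ {1, ∞}`
into the bidual, then such approximations of `T` factor through finite dimensional spaces `ℓ_p^ι`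
with almost the same norms. Indeed the identity of `L_p(μ)` is approximated by operators that factor
through `ℓ_p^ι` (`exists_approx_lp_top`, `exists_approx_lp_one`), and an operator from `ℓ_p^ι` into
the bidual may be pushed down to the space itself by a weak form of local reflexivity
(`exists_continuousLinearMap_of_bidual`). Then `β` is compared with its hulls by the metric
extension property of `ℓ_∞^ι` and by the definition of the projective hull through `ℓ_1^ι`. No
extension of polynomials to the bidual is needed. The remaining inequalities are the Hahn–Banach theorem, which extends a functional from
`⊗ⁿ E` to `⊗ⁿ ℓ_∞(B_{E'})`, and the fact that operators of norm at most one on `ℓ_1^ι`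
have norm at most one in `𝓛_1` (`factorable_one_le_one`).
-/

noncomputable section

namespace SymTensorNorms

open Filter Topology

/-! ### Linear algebra of symmetric tensor powers -/

section Algebra

variable {𝕜 : Type} [RCLike 𝕜] {n : ℕ} {E F G : Type u} [AddCommGroup E] [Module 𝕜 E]
  [AddCommGroup F] [Module 𝕜 F] [AddCommGroup G] [Module 𝕜 G]

theorem exists_sum_symPow (z : symTensor 𝕜 n E) :
    ∃ (m : ℕ) (c : Fin m → 𝕜) (x : Fin m → E), z = ∑ j, c j • symPow 𝕜 n (x j) := by
  obtain ⟨m, c, g, h⟩ := Submodule.mem_span_set'.1 z.2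
  choose x hx using fun i => (g i).2
  refine ⟨m, c, x, Subtype.ext ?_⟩
  rw [← h]
  simp only [Submodule.coe_sum, Submodule.coe_smul]
  exact Finset.sum_congr rfl fun i _ => by rw [← hx i]; rfl

theorem symTensor_hom_ext {H : Type*} [AddCommGroup H] [Module 𝕜 H]
    {φ ψ : symTensor 𝕜 n E →ₗ[𝕜] H}
    (h : ∀ x, φ (symPow 𝕜 n x) = ψ (symPow 𝕜 n x)) : φ = ψ := by
  ext z
  obtain ⟨m, c, x, rfl⟩ := exists_sum_symPow z
  simp [h]

theorem symPow_smul (c : 𝕜) (x : E) : symPow 𝕜 n (c • x) = c ^ n • symPow 𝕜 n x := by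
  apply Subtype.ext
  have := (PiTensorProduct.tprod 𝕜).map_smul_univ (fun _ : Fin n => c) (fun _ : Fin n => x)
  simpa [symPow] using this

theorem symMap_comp_apply (T : F →ₗ[𝕜] G) (S : E →ₗ[𝕜] F) (z : symTensor 𝕜 n E) :
    symMap n T (symMap n S z) = symMap n (T ∘ₗ S) z := by
  have : symMap n T ∘ₗ symMap n S = symMap n (T ∘ₗ S) :=
    symTensor_hom_ext fun x => by simp [symMap_symPow]
  exact LinearMap.congr_fun this z

theorem symMap_id_apply (z : symTensor 𝕜 n E) : symMap n (LinearMap.id : E →ₗ[𝕜] E) z = z := by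
  have : symMap n (LinearMap.id : E →ₗ[𝕜] E) = LinearMap.id :=
    symTensor_hom_ext fun x => by simp [symMap_symPow]
  exact LinearMap.congr_fun this z

theorem symMap_smul_apply (c : 𝕜) (T : E →ₗ[𝕜] F) (z : symTensor 𝕜 n E) :
    symMap n (c • T) z = c ^ n • symMap n T z := by
  have : symMap n (c • T) = c ^ n • symMap n T :=
    symTensor_hom_ext fun x => by simp [symMap_symPow, symPow_smul]
  exact LinearMap.congr_fun this z

theorem symMap_sum (T : E →ₗ[𝕜] F) {m : ℕ} (c : Fin m → 𝕜) (x : Fin m → E) :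
    symMap n T (∑ j, c j • symPow 𝕜 n (x j)) = ∑ j, c j • symPow 𝕜 n (T (x j)) := by
  simp [symMap_symPow]

theorem symMap_injective {T : E →ₗ[𝕜] F} (hT : Function.Injective T) :
    Function.Injective (symMap n T) := by
  obtain ⟨S, hS⟩ := T.exists_leftInverse_of_injective (LinearMap.ker_eq_bot.2 hT)
  refine Function.LeftInverse.injective (g := symMap n S) fun z => ?_
  rw [symMap_comp_apply, hS, symMap_id_apply]

theorem symMap_surjective {T : E →ₗ[𝕜] F} (hT : Function.Surjective T) :
    Function.Surjective (symMap n T) := by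
  intro z
  obtain ⟨m, c, x, rfl⟩ := exists_sum_symPow z
  choose y hy using fun j => hT (x j)
  exact ⟨∑ j, c j • symPow 𝕜 n (y j), by rw [symMap_sum]; simp only [hy]⟩

theorem powFunctional_symMap (φ : F →ₗ[𝕜] 𝕜) (T : E →ₗ[𝕜] F) (z : symTensor 𝕜 n E) :
    powFunctional n φ (symMap n T z) = powFunctional n (φ ∘ₗ T) z := by
  have : powFunctional n φ ∘ₗ symMap n T = powFunctional n (φ ∘ₗ T) :=
    symTensor_hom_ext fun x => by simp [symMap_symPow, powFunctional_symPow]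
  exact LinearMap.congr_fun this z

/-- Every symmetric tensor lives on a finite dimensional subspace. -/
theorem exists_finiteDimensional_symMap_subtype (z : symTensor 𝕜 n E) :
    ∃ (M : Submodule 𝕜 E) (_ : FiniteDimensional 𝕜 M) (w : symTensor 𝕜 n M),
      symMap n M.subtype w = z := by
  obtain ⟨m, c, x, rfl⟩ := exists_sum_symPow z
  refine ⟨Submodule.span 𝕜 (Set.range x), FiniteDimensional.span_of_finite 𝕜 (Set.finite_range x),
    ∑ j, c j • symPow 𝕜 n ⟨x j, Submodule.subset_span ⟨j, rfl⟩⟩, ?_⟩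
  rw [symMap_sum]
  rfl

end Algebra

/-! ### The Hahn–Banach theorem for seminorms -/

section HahnBanach

variable {𝕜 : Type} [RCLike 𝕜] {V W : Type*} [AddCommGroup V] [Module 𝕜 V] [AddCommGroup W]
  [Module 𝕜 W]

/-- A functional on `V` dominated by a multiple of a seminorm pulled back along an injective map
`j : V → W` extends along `j`. -/
theorem exists_extension_of_injective {j : V →ₗ[𝕜] W} (hj : Function.Injective j)
    (p : Seminorm 𝕜 W) (C : ℝ≥0) (φ : V →ₗ[𝕜] 𝕜) (h : ∀ v, ‖φ v‖ ≤ C * p (j v)) :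
    ∃ ψ : W →ₗ[𝕜] 𝕜, (∀ v, ψ (j v) = φ v) ∧ ∀ w, ‖ψ w‖ ≤ C * p w := by
  let e := LinearEquiv.ofInjective j hj
  obtain ⟨ψ, h1, h2⟩ := Module.Dual.exists_extension_of_le_seminorm (LinearMap.range j)
    (φ ∘ₗ e.symm.toLinearMap) (p := C • p) (by
      intro x
      obtain ⟨v, rfl⟩ := e.surjective x
      simpa [e, NNReal.smul_def] using h v)
  refine ⟨ψ, fun v => ?_, fun w => by simpa [NNReal.smul_def] using h2 w⟩
  have := h1 (e v)
  simpa [e] using this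

theorem exists_functional_eq_seminorm (p : Seminorm 𝕜 V) (v : V) :
    ∃ ψ : V →ₗ[𝕜] 𝕜, ψ v = p v ∧ ∀ w, ‖ψ w‖ ≤ p w := by
  by_cases hv : v = 0
  · exact ⟨0, by simp [hv], by simp⟩
  have hj : Function.Injective (LinearMap.toSpanSingleton 𝕜 V v) :=
    LinearMap.ker_eq_bot.1 (LinearMap.ker_toSpanSingleton 𝕜 hv)
  obtain ⟨ψ, h1, h2⟩ := exists_extension_of_injective hj p 1
    ((p v : 𝕜) • LinearMap.id) (fun a => by
      simp [-algebraMap_smul, map_smul_eq_mul, abs_of_nonneg (apply_nonneg p v), mul_comm])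
  exact ⟨ψ, by simpa [-algebraMap_smul] using h1 1, by simpa using h2⟩

end HahnBanach

/-! ### Polynomials and functionals on symmetric tensors -/

section Polynomials

variable {𝕜 : Type} [RCLike 𝕜] {n : ℕ} {E F : Type u} [NormedAddCommGroup E] [NormedSpace 𝕜 E]
  [NormedAddCommGroup F] [NormedSpace 𝕜 F]

theorem HomPoly.exists_functional (p : HomPoly 𝕜 n E) :
    ∃ φ : symTensor 𝕜 n E →ₗ[𝕜] 𝕜, ∀ x, φ (symPow 𝕜 n x) = p.1 x := by
  obtain ⟨A, hA⟩ := p.2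
  exact ⟨(PiTensorProduct.lift A.toMultilinearMap).domRestrict _, fun x => by simp [symPow, hA]⟩

/-- The linearization of a homogeneous polynomial `p`: the functional on the symmetric tensor
product which sends `⊗ⁿ x` to `p x`. -/
def HomPoly.functional (p : HomPoly 𝕜 n E) : symTensor 𝕜 n E →ₗ[𝕜] 𝕜 :=
  p.exists_functional.choose

@[simp]
theorem HomPoly.functional_symPow (p : HomPoly 𝕜 n E) (x : E) :
    p.functional (symPow 𝕜 n x) = p.1 x :=
  p.exists_functional.choose_spec x

theorem HomPoly.eq_functional {p : HomPoly 𝕜 n E} {φ : symTensor 𝕜 n E →ₗ[𝕜] 𝕜}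
    (h : ∀ x, φ (symPow 𝕜 n x) = p.1 x) : φ = p.functional :=
  symTensor_hom_ext fun x => by rw [h, functional_symPow]

theorem HomPoly.functional_comp (q : HomPoly 𝕜 n F) (T : E →L[𝕜] F) (z : symTensor 𝕜 n E) :
    (q.comp T).functional z = q.functional (symMap n T.toLinearMap z) := by
  have : q.functional ∘ₗ symMap n T.toLinearMap = (q.comp T).functional :=
    HomPoly.eq_functional fun x => by simp [symMap_symPow, HomPoly.comp]
  exact (LinearMap.congr_fun this z).symm

theorem HomPoly.continuous (p : HomPoly 𝕜 n E) : Continuous p.1 := by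
  obtain ⟨A, hA⟩ := p.2
  have : p.1 = fun x => A fun _ => x := funext hA
  rw [this]
  exact A.cont.comp (continuous_pi fun _ => continuous_id)

/-- The norm of the polynomial `p` in `𝒬_β` is the norm of its linearization; in particular the
infimum in its definition is attained. -/
theorem ofTensorNorm_norm_le_iff [CompleteSpace E] (β : STensorNorm.{u} 𝕜 n) (p : HomPoly 𝕜 n E)
    (C : ℝ≥0) : (PolyClass.ofTensorNorm β).norm E p ≤ C ↔
      ∀ z, ‖p.functional z‖ ≤ C * β.norm E z := by
  constructor
  · intro h z
    refine le_of_forall_gt_imp_ge_of_dense fun r hr => ?_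
    have hlim : Tendsto (fun D : ℝ => D * β.norm E z) (𝓝[>] (C : ℝ)) (𝓝 (C * β.norm E z)) :=
      ((continuous_id.mul continuous_const).tendsto (C : ℝ)).mono_left nhdsWithin_le_nhds
    obtain ⟨D, hD, hCD⟩ := ((hlim.eventually (gt_mem_nhds hr)).and self_mem_nhdsWithin).exists
    have hCD' : (C : ℝ) < D := hCD
    have hD0 : 0 ≤ D := C.2.trans hCD'.le
    have hlt : (PolyClass.ofTensorNorm β).norm E p < ((NNReal.mk D hD0 : ℝ≥0) : ℝ≥0∞) :=
      h.trans_lt (ENNReal.coe_lt_coe.2 hCD')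
    obtain ⟨_, ⟨φ, K, h1, h2, rfl⟩, hK⟩ := sInf_lt_iff.1 hlt
    rw [← HomPoly.eq_functional h1]
    have hK' : (K : ℝ) ≤ D := le_of_lt (ENNReal.coe_lt_coe.1 hK)
    exact (h2 z).trans ((mul_le_mul_of_nonneg_right hK' (apply_nonneg _ z)).trans hD.le)
  · intro h
    exact sInf_le ⟨p.functional, C, p.functional_symPow, h, rfl⟩

/-- If the operators `U` approximate `T` on finite sets, then bounds for the linearization of `q`
at `⊗ⁿ U z` pass to `⊗ⁿ T z`. -/
theorem HomPoly.norm_functional_symMap_le (q : HomPoly 𝕜 n F) (T : E →L[𝕜] F)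
    (z : symTensor 𝕜 n E) (g : ℝ → ℝ) (hg : Continuous g)
    (h : ∀ (k : ℕ) (x : Fin k → E) (ε : ℝ), 0 < ε → ∃ U : E →L[𝕜] F,
      (∀ j, ‖U (x j) - T (x j)‖ ≤ ε) ∧ ‖q.functional (symMap n U.toLinearMap z)‖ ≤ g ε) :
    ‖q.functional (symMap n T.toLinearMap z)‖ ≤ g 0 := by
  obtain ⟨m, c, x, hz⟩ := exists_sum_symPow z
  have hε : ∀ i : ℕ, (0 : ℝ) < 1 / ((i : ℝ) + 1) := fun i => by positivity
  choose U hU1 hU2 using fun i : ℕ => h m x (1 / ((i : ℝ) + 1)) (hε i)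
  have h0 : Tendsto (fun i : ℕ => 1 / ((i : ℝ) + 1)) atTop (𝓝 0) :=
    tendsto_one_div_add_atTop_nhds_zero_nat
  have hUT : ∀ j, Tendsto (fun i => U i (x j)) atTop (𝓝 (T (x j))) := fun j =>
    tendsto_iff_norm_sub_tendsto_zero.2
      (squeeze_zero (fun _ => norm_nonneg _) (fun i => hU1 i j) h0)
  have hval : ∀ V : E →L[𝕜] F,
      q.functional (symMap n V.toLinearMap z) = ∑ j, c j * q.1 (V (x j)) := fun V => by
    simp [hz, symMap_symPow]
  have hlim : Tendsto (fun i => ‖q.functional (symMap n (U i).toLinearMap z)‖) atTop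
      (𝓝 ‖q.functional (symMap n T.toLinearMap z)‖) := by
    simp only [hval]
    exact (tendsto_finsetSum _ fun j _ =>
      ((q.continuous.tendsto _).comp (hUT j)).const_mul (c j)).norm
  exact le_of_tendsto_of_tendsto' hlim ((hg.tendsto 0).comp h0) hU2

/-- The polarization formula: a multilinear form is determined, up to symmetrization, by its
values on the diagonal. -/
theorem polarization (A : MultilinearMap 𝕜 (fun _ : Fin n => E) 𝕜) (x : Fin n → E) :
    (2 : 𝕜) ^ n * ∑ σ : Equiv.Perm (Fin n), A (fun i => x (σ i)) =
      ∑ ε : Fin n → ℤˣ, (∏ i, ((ε i : ℤ) : 𝕜)) * A fun _ => ∑ i, ((ε i : ℤ) : 𝕜) • x i := by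
  classical
  have hexp : ∀ ε : Fin n → ℤˣ, A (fun _ => ∑ i, ((ε i : ℤ) : 𝕜) • x i) =
      ∑ f : Fin n → Fin n, (∏ k, ((ε (f k) : ℤ) : 𝕜)) * A fun k => x (f k) := fun ε => by
    rw [MultilinearMap.map_sum]
    exact Finset.sum_congr rfl fun f _ => by
      rw [← smul_eq_mul, ← MultilinearMap.map_smul_univ]
  have hswap : ∑ ε : Fin n → ℤˣ, (∏ i, ((ε i : ℤ) : 𝕜)) *
        A (fun _ => ∑ i, ((ε i : ℤ) : 𝕜) • x i) =
      ∑ f : Fin n → Fin n, (∑ ε : Fin n → ℤˣ, (∏ i, ((ε i : ℤ) : 𝕜)) *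
        ∏ k, ((ε (f k) : ℤ) : 𝕜)) * A fun k => x (f k) := by
    simp only [hexp, Finset.mul_sum, Finset.sum_mul]
    rw [Finset.sum_comm]
    simp only [mul_assoc]
  have hbij : ∀ f : Fin n → Fin n, Function.Bijective f →
      ∑ ε : Fin n → ℤˣ, (∏ i, ((ε i : ℤ) : 𝕜)) * ∏ k, ((ε (f k) : ℤ) : 𝕜) = 2 ^ n := by
    intro f hf
    have h1 : ∀ ε : Fin n → ℤˣ, (∏ i, ((ε i : ℤ) : 𝕜)) * ∏ k, ((ε (f k) : ℤ) : 𝕜) = 1 := by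
      intro ε
      rw [hf.prod_comp fun i => ((ε i : ℤ) : 𝕜), ← Finset.prod_mul_distrib]
      refine Finset.prod_eq_one fun i _ => ?_
      rcases Int.units_eq_one_or (ε i) with h | h <;> simp [h]
    simp [h1]
  have hnot : ∀ f : Fin n → Fin n, ¬ Function.Bijective f →
      ∑ ε : Fin n → ℤˣ, (∏ i, ((ε i : ℤ) : 𝕜)) * ∏ k, ((ε (f k) : ℤ) : 𝕜) = 0 := by
    intro f hf
    have hs : ¬ Function.Surjective f := fun h => hf (Finite.surjective_iff_bijective.1 h)
    obtain ⟨a, ha⟩ := not_forall.1 hs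
    have ha' : ∀ k, f k ≠ a := fun k hk => ha ⟨k, hk⟩
    -- flipping the sign at an index missed by `f` negates every summand
    let s : Fin n → ℤˣ := Function.update 1 a (-1)
    have hsum := (Equiv.sum_comp (Equiv.mulLeft s) fun ε : Fin n → ℤˣ =>
      (∏ i, ((ε i : ℤ) : 𝕜)) * ∏ k, ((ε (f k) : ℤ) : 𝕜))
    have hs1 : ∏ i, ((s i : ℤ) : 𝕜) = -1 := by
      rw [Finset.prod_eq_single a (fun b _ hb => by simp [s, hb]) (by simp)]
      simp [s]
    have hflip : ∀ ε : Fin n → ℤˣ,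
        (∏ i, (((s * ε) i : ℤ) : 𝕜)) * ∏ k, (((s * ε) (f k) : ℤ) : 𝕜) =
          -((∏ i, ((ε i : ℤ) : 𝕜)) * ∏ k, ((ε (f k) : ℤ) : 𝕜)) := by
      intro ε
      have h2 : ∀ k, (((s * ε) (f k) : ℤ) : 𝕜) = ((ε (f k) : ℤ) : 𝕜) := fun k => by
        simp [s, ha' k]
      simp only [h2]
      simp only [Pi.mul_apply, Units.val_mul, Int.cast_mul, Finset.prod_mul_distrib, hs1]
      ring
    simp only [Equiv.coe_mulLeft, hflip, Finset.sum_neg_distrib] at hsum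
    exact self_eq_neg.1 hsum.symm
  rw [hswap, ← Finset.sum_subset (Finset.subset_univ (Finset.univ.filter Function.Bijective))
    (fun f _ hf => by rw [hnot f (by simpa using hf), zero_mul]), Finset.mul_sum]
  refine Finset.sum_bij (fun σ _ => ⇑σ) (fun σ _ => by
      rw [Finset.mem_filter]; exact ⟨Finset.mem_univ _, σ.bijective⟩)
    (fun σ _ τ _ h => Equiv.coe_fn_injective h)
    (fun f hf => ⟨Equiv.ofBijective f (by simpa using hf), Finset.mem_univ _, rfl⟩) ?_
  intro σ _
  rw [hbij σ σ.bijective]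

/-- A functional on symmetric tensors which is bounded on the powers of unit vectors is the
linearization of a continuous homogeneous polynomial: its associated symmetric multilinear form is
bounded, by polarization. -/
theorem exists_homPoly (φ : symTensor 𝕜 n E →ₗ[𝕜] 𝕜) (C : ℝ) (hC : 0 ≤ C)
    (h : ∀ x, ‖φ (symPow 𝕜 n x)‖ ≤ C * ‖x‖ ^ n) :
    ∃ q : HomPoly 𝕜 n E, q.functional = φ := by
  classical
  obtain ⟨L, hL⟩ := φ.exists_extend
  let A : MultilinearMap 𝕜 (fun _ : Fin n => E) 𝕜 := L.compMultilinearMap (PiTensorProduct.tprod 𝕜)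
  have hA : ∀ x, A (fun _ => x) = φ (symPow 𝕜 n x) := fun x => by
    rw [← hL]; rfl
  let B : MultilinearMap 𝕜 (fun _ : Fin n => E) 𝕜 :=
    ∑ σ : Equiv.Perm (Fin n), A.domDomCongr σ
  have hB : ∀ x, B x = ∑ σ : Equiv.Perm (Fin n), A fun i => x (σ i) := fun x => by
    simp [B, sum_apply]
  have hunit : ∀ e : ℤˣ, ‖((e : ℤ) : 𝕜)‖ = 1 := fun e => by
    rcases Int.units_eq_one_or e with h | h <;> simp [h]
  have hball : ∀ y : Fin n → E, (∀ i, ‖y i‖ ≤ 1) → ‖B y‖ ≤ C * (n : ℝ) ^ n := by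
    intro y hy
    have h2 : ‖(2 : 𝕜) ^ n * B y‖ ≤ 2 ^ n * (C * (n : ℝ) ^ n) := by
      rw [hB, polarization]
      refine (norm_sum_le _ _).trans ((Finset.sum_le_card_nsmul _ _ (C * (n : ℝ) ^ n) ?_).trans ?_)
      · intro ε _
        rw [norm_mul, norm_prod, Finset.prod_eq_one fun i _ => hunit _, one_mul, hA]
        refine (h _).trans (mul_le_mul_of_nonneg_left (pow_le_pow_left₀ (norm_nonneg _) ?_ n) hC)
        refine (norm_sum_le_of_le _ (fun i _ => (?_ : _ ≤ (1 : ℝ)))).trans (by simp)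
        rw [norm_smul, hunit, one_mul]
        exact hy i
      · simp
    rw [norm_mul, norm_pow, RCLike.norm_ofNat] at h2
    exact le_of_mul_le_mul_left h2 (by positivity)
  have hbound : ∀ x, ‖B x‖ ≤ C * (n : ℝ) ^ n * ∏ i, ‖x i‖ := by
    intro x
    by_cases hx : ∃ i, x i = 0
    · obtain ⟨i, hi⟩ := hx
      rw [B.map_coord_zero i hi, norm_zero]
      positivity
    · have hx' : ∀ i, (‖x i‖ : 𝕜) ≠ 0 := fun i => by
        simpa using fun hi => hx ⟨i, hi⟩
      have hxy : x = fun i => (‖x i‖ : 𝕜) • ((‖x i‖ : 𝕜)⁻¹ • x i) := by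
        ext i
        rw [smul_inv_smul₀ (hx' i)]
      conv_lhs => rw [hxy]
      rw [MultilinearMap.map_smul_univ, norm_smul, norm_prod, mul_comm]
      simp only [RCLike.norm_ofReal, abs_norm]
      refine mul_le_mul_of_nonneg_right (hball _ fun i => ?_) (by positivity)
      rw [norm_smul, norm_inv, RCLike.norm_ofReal, abs_norm]
      exact inv_mul_le_one
  let Bc := B.mkContinuous _ hbound
  have hn : ((n.factorial : ℕ) : 𝕜) ≠ 0 := by exact_mod_cast n.factorial_ne_zero
  let q : HomPoly 𝕜 n E := ⟨fun x => φ (symPow 𝕜 n x), ((n.factorial : ℕ) : 𝕜)⁻¹ • Bc, fun x => by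
    have : B (fun _ => x) = ((n.factorial : ℕ) : 𝕜) * φ (symPow 𝕜 n x) := by
      rw [hB]
      simp [hA, Fintype.card_perm]
    simp [Bc, this, hn]⟩
  exact ⟨q, (HomPoly.eq_functional (p := q) fun x => rfl).symm⟩

end Polynomials

/-! ### A finite form of local reflexivity -/

section LocalReflexivity

variable {𝕜 : Type} [RCLike 𝕜] {W F : Type*} [NormedAddCommGroup W] [NormedSpace 𝕜 W]
  [FiniteDimensional 𝕜 W] [NormedAddCommGroup F] [NormedSpace 𝕜 F]

/-- A Helly type lemma: finitely many approximate norm constraints which are satisfied by an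
operator into the bidual can be satisfied, up to `ε`, by an operator into the space itself.
Otherwise the affine subspace of all `(S' uᵢ - tᵢ)ᵢ` misses a product of balls, and a separating functional, which
annihilates all `(S' uᵢ)ᵢ` and therefore also `(S uᵢ)ᵢ`, contradicts the constraints for `S`. -/
theorem exists_linearMap_norm_sub_lt {ι : Type*} [Finite ι]
    (S : W →ₗ[𝕜] StrongDual 𝕜 (StrongDual 𝕜 F)) (u : ι → W) (t : ι → F) (ρ : ι → ℝ)
    (h : ∀ i, ‖S (u i) - NormedSpace.inclusionInDoubleDual 𝕜 F (t i)‖ ≤ ρ i) {ε : ℝ} (hε : 0 < ε) :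
    ∃ S' : W →ₗ[𝕜] F, ∀ i, ‖S' (u i) - t i‖ < ρ i + ε := by
  classical
  have := Fintype.ofFinite ι
  have hρ : ∀ i, 0 ≤ ρ i := fun i => (norm_nonneg _).trans (h i)
  let : NormedSpace ℝ F := NormedSpace.restrictScalars ℝ 𝕜 F
  have : IsScalarTower ℝ 𝕜 F := IsScalarTower.of_algebraMap_smul fun r x => rfl
  by_contra! hcon
  let O : Set (ι → F) := Set.pi Set.univ fun i => Metric.ball 0 (ρ i + ε)
  let K : Set (ι → F) := Set.range fun S' : W →ₗ[𝕜] F => fun i => S' (u i) - t i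
  have hO1 : Convex ℝ O := convex_pi fun i _ => convex_ball _ _
  have hO2 : IsOpen O := isOpen_set_pi Set.finite_univ fun i _ => Metric.isOpen_ball
  have hK : Convex ℝ K := by
    rintro _ ⟨A, rfl⟩ _ ⟨B, rfl⟩ a b _ _ hab
    refine ⟨(a : 𝕜) • A + (b : 𝕜) • B, ?_⟩
    ext i
    have ht : t i = (a : 𝕜) • t i + (b : 𝕜) • t i := by
      rw [← add_smul, ← RCLike.ofReal_add, hab]; simp
    have hsm : ∀ (r : ℝ) (x : F), r • x = (r : 𝕜) • x := fun r x => rfl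
    simp only [LinearMap.add_apply, LinearMap.smul_apply, Pi.add_apply, Pi.smul_apply, hsm,
      smul_sub]
    nth_rewrite 1 [ht]
    abel
  have hdisj : Disjoint O K := by
    rw [Set.disjoint_right]
    rintro _ ⟨A, rfl⟩ hA
    obtain ⟨i, hi⟩ := hcon A
    have := hA i (Set.mem_univ i)
    rw [mem_ball_zero_iff] at this
    exact absurd this (not_lt.2 hi)
  obtain ⟨f, s, hfO, hfK⟩ := RCLike.geometric_hahn_banach_open (𝕜 := 𝕜) hO1 hO2 hK hdisj
  let g : ι → StrongDual 𝕜 F := fun i => f.comp (ContinuousLinearMap.single 𝕜 (fun _ => F) i)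
  have hfg : ∀ v, f v = ∑ i, g i (v i) := fun v => by
    conv_lhs => rw [← Finset.univ_sum_single v]
    simp [g]
  -- `f` is bounded below on an affine subspace, so it vanishes on its direction
  have hvan : ∀ A : W →ₗ[𝕜] F, ∑ i, g i (A (u i)) = 0 := by
    intro A
    by_contra hc
    set c := ∑ i, g i (A (u i)) with hcdef
    have hc' : 0 < ‖c‖ ^ 2 := by positivity
    let r : ℝ := (1 - s - RCLike.re (∑ i, g i (t i))) / ‖c‖ ^ 2
    have h1 := hfK _ ⟨(-(r : 𝕜) * (starRingEnd 𝕜) c) • A, rfl⟩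
    have h2 : f (fun i => ((-(r : 𝕜) * (starRingEnd 𝕜) c) • A) (u i) - t i) =
        (-(r : 𝕜) * (starRingEnd 𝕜) c) * c - ∑ i, g i (t i) := by
      rw [hfg, hcdef, Finset.mul_sum, ← Finset.sum_sub_distrib]
      simp
    have h3 : (-(r : 𝕜) * (starRingEnd 𝕜) c) * c = ((-(r * ‖c‖ ^ 2) : ℝ) : 𝕜) := by
      rw [mul_assoc, RCLike.conj_mul]; push_cast; ring
    have h4 : r * ‖c‖ ^ 2 = 1 - s - RCLike.re (∑ i, g i (t i)) := div_mul_cancel₀ _ hc'.ne'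
    rw [h2, h3, map_sub, RCLike.ofReal_re, h4] at h1
    linarith
  have hS : ∑ i, S (u i) (g i) = 0 := by
    let b := Module.finBasis 𝕜 W
    have hu : ∀ i, S (u i) (g i) = ∑ k, S (b k) ((b.repr (u i) k) • g i) := fun i => by
      conv_lhs => rw [← b.sum_repr (u i), map_sum]
      simp [sum_apply]
    have hk : ∀ k, ∑ i, (b.repr (u i) k) • g i = 0 := fun k => by
      ext y
      have := hvan ((b.coord k).smulRight y)
      simpa [sum_apply] using this
    simp only [hu]
    rw [Finset.sum_comm]
    refine Finset.sum_eq_zero fun k _ => ?_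
    rw [← map_sum, hk, map_zero]
  have hs : s ≤ ∑ i, ρ i * ‖g i‖ := by
    have h1 := hfK _ ⟨0, rfl⟩
    have h2 : f (fun i => (0 : W →ₗ[𝕜] F) (u i) - t i) =
        ∑ i, (S (u i) - NormedSpace.inclusionInDoubleDual 𝕜 F (t i)) (g i) := by
      rw [hfg]
      simp [Finset.sum_sub_distrib, hS, NormedSpace.dual_def]
    rw [h2] at h1
    refine h1.trans ((RCLike.re_le_norm _).trans ((norm_sum_le _ _).trans ?_))
    exact Finset.sum_le_sum fun i _ => (ContinuousLinearMap.le_opNorm _ _).trans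
      (mul_le_mul_of_nonneg_right (h i) (norm_nonneg _))
  have hball : ∀ i, ∃ o : F, ‖o‖ < ρ i + ε ∧ ρ i * ‖g i‖ ≤ RCLike.re (g i o) := by
    intro i
    have hpos : 0 < ρ i + ε := add_pos_of_nonneg_of_pos (hρ i) hε
    by_cases hg : ‖g i‖ = 0
    · exact ⟨0, by simpa using hpos, by simp [hg]⟩
    have hg' : 0 < ‖g i‖ := lt_of_le_of_ne (norm_nonneg _) (Ne.symm hg)
    have hlt : ρ i / (ρ i + ε) * ‖g i‖ < ‖g i‖ :=
      mul_lt_of_lt_one_left hg' ((div_lt_one hpos).2 (by linarith))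
    obtain ⟨x, hx1, hx2⟩ := (g i).exists_lt_apply_of_lt_opNorm hlt
    obtain ⟨a, ha1, ha2⟩ : ∃ a : 𝕜, ‖a‖ = 1 ∧ a * g i x = (‖g i x‖ : 𝕜) := by
      by_cases h0 : g i x = 0
      · exact ⟨1, by simp, by simp [h0]⟩
      · have h0' : (‖g i x‖ : 𝕜) ≠ 0 := by simpa using h0
        exact ⟨‖g i x‖ / g i x, by simp [h0], div_mul_cancel₀ _ h0⟩
    refine ⟨((ρ i + ε : ℝ) : 𝕜) • a • x, ?_, ?_⟩
    · rw [norm_smul, norm_smul, ha1, one_mul, RCLike.norm_ofReal, abs_of_pos hpos]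
      exact mul_lt_of_lt_one_right hpos hx1
    · rw [(g i).map_smul, (g i).map_smul, smul_eq_mul, smul_eq_mul, ha2, ← RCLike.ofReal_mul,
        RCLike.ofReal_re]
      have := mul_le_mul_of_nonneg_left hx2.le hpos.le
      rwa [← mul_assoc, mul_div_cancel₀ _ hpos.ne'] at this
  choose o ho1 ho2 using hball
  have h1 := hfO o fun i _ => by simpa using ho1 i
  rw [hfg, map_sum] at h1
  exact absurd (hs.trans (Finset.sum_le_sum fun i _ => ho2 i)) (not_le.2 h1)

/-- A weak form of the principle of local reflexivity: an operator from a finite dimensional space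
into the bidual of `F` which sends finitely many points close to points of `F` can be replaced by an
operator into `F` with almost the same norm. -/
theorem exists_continuousLinearMap_of_bidual (S : W →L[𝕜] StrongDual 𝕜 (StrongDual 𝕜 F)) {k : ℕ}
    (w : Fin k → W) (y : Fin k → F) (δ : ℝ)
    (h : ∀ j, ‖S (w j) - NormedSpace.inclusionInDoubleDual 𝕜 F (y j)‖ ≤ δ) {ε : ℝ} (hε : 0 < ε) :
    ∃ S' : W →L[𝕜] F, ‖S'‖ ≤ ‖S‖ + ε ∧ ∀ j, ‖S' (w j) - y j‖ ≤ δ + ε := by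
  classical
  -- `η` is chosen so that `(‖S‖ + ε / 2) / (1 - η) = ‖S‖ + ε`
  let N : ℝ := ‖S‖
  have hN : 0 ≤ N := norm_nonneg _
  let η : ℝ := (ε / 2) / (N + ε)
  have hNε : 0 < N + ε := by positivity
  have hη : 0 < η := by positivity
  have hη1 : η * (N + ε) = ε / 2 := div_mul_cancel₀ _ hNε.ne'
  have hη2 : η < 1 := (div_lt_one hNε).2 (by linarith)
  have : ProperSpace W := FiniteDimensional.proper_rclike 𝕜 W
  obtain ⟨net, hnet1, hnet2, hnet⟩ :=
    (isCompact_closedBall (0 : W) 1).finite_cover_balls hη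
  have := hnet2.to_subtype
  obtain ⟨S', hS'⟩ := exists_linearMap_norm_sub_lt (ι := net ⊕ Fin k) S.toLinearMap
    (Sum.elim (fun v => v.1) w) (Sum.elim (fun _ => 0) y) (Sum.elim (fun _ => N) fun _ => δ) (by
      rintro (v | j)
      · have hv := hnet1 v.2
        rw [mem_closedBall_zero_iff] at hv
        simpa using S.le_of_opNorm_le_of_le le_rfl hv
      · simpa using h j) (half_pos hε)
  refine ⟨S'.toContinuousLinearMap, ?_, fun j => ?_⟩
  · have hball : ∀ v : W, ‖v‖ ≤ 1 →
        ‖S'.toContinuousLinearMap v‖ ≤ (N + ε / 2) + η * ‖S'.toContinuousLinearMap‖ := by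
      intro v hv
      obtain ⟨a, ha, hva⟩ := Set.mem_iUnion₂.1 (hnet (mem_closedBall_zero_iff.2 hv))
      have h1 : ‖S'.toContinuousLinearMap a‖ ≤ N + ε / 2 := by
        simpa using (hS' (Sum.inl ⟨a, ha⟩)).le
      have h2 : ‖S'.toContinuousLinearMap (v - a)‖ ≤ ‖S'.toContinuousLinearMap‖ * η :=
        S'.toContinuousLinearMap.le_of_opNorm_le_of_le le_rfl
          (by simpa [dist_eq_norm] using (Metric.mem_ball.1 hva).le)
      calc ‖S'.toContinuousLinearMap v‖
          = ‖S'.toContinuousLinearMap a + S'.toContinuousLinearMap (v - a)‖ := by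
            rw [← map_add, add_sub_cancel]
        _ ≤ _ := (norm_add_le _ _).trans (by linarith)
    have hle : ‖S'.toContinuousLinearMap‖ ≤ (N + ε / 2) + η * ‖S'.toContinuousLinearMap‖ := by
      refine ContinuousLinearMap.opNorm_le_of_unit_norm (by positivity) fun v hv => hball v hv.le
    have : (1 - η) * ‖S'.toContinuousLinearMap‖ ≤ (1 - η) * (N + ε) := by nlinarith
    exact le_of_mul_le_mul_left this (by linarith)
  · have := (hS' (Sum.inr j)).le
    simp only [Sum.elim_inr] at this
    exact this.trans (by linarith)

end LocalReflexivity

open MeasureTheory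

/-! ### Finite rank approximation in `L_∞`, `L_1` and `ℓ_1` -/

section Approximation

variable {𝕜 : Type} [RCLike 𝕜]

theorem norm_lp_top_le {Ω : Type*} [MeasurableSpace Ω] {μ : Measure Ω} (f : Lp 𝕜 ⊤ μ) {C : ℝ}
    (hC : 0 ≤ C) (h : ∀ᵐ ω ∂μ, ‖f ω‖ ≤ C) : ‖f‖ ≤ C := by
  rw [Lp.norm_def, eLpNorm_exponent_top]
  refine ENNReal.toReal_le_of_le_ofReal hC (eLpNormEssSup_le_of_ae_bound h)

theorem ae_norm_le_norm_lp_top {Ω : Type*} [MeasurableSpace Ω] {μ : Measure Ω} (f : Lp 𝕜 ⊤ μ) :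
    ∀ᵐ ω ∂μ, ‖f ω‖ ≤ ‖f‖ := by
  have hfin := Lp.eLpNorm_ne_top f
  rw [eLpNorm_exponent_top] at hfin
  filter_upwards [ae_le_eLpNormEssSup (f := f) (μ := μ)] with ω hω
  rw [Lp.norm_def, eLpNorm_exponent_top]
  have := ENNReal.toReal_mono hfin hω
  rwa [toReal_enorm] at this

/-- A uniformly bounded linear map into measurable functions defines an operator into `L_∞`. -/
theorem exists_clm_lp_top {X : Type*} [NormedAddCommGroup X] [NormedSpace 𝕜 X] {Ω : Type*}
    [MeasurableSpace Ω] (μ : Measure Ω) (T : X →ₗ[𝕜] Ω → 𝕜)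
    (hT : ∀ x, AEStronglyMeasurable (T x) μ) {C : ℝ} (hC : 0 ≤ C)
    (h : ∀ x ω, ‖T x ω‖ ≤ C * ‖x‖) :
    ∃ R : X →L[𝕜] Lp 𝕜 ⊤ μ, ‖R‖ ≤ C ∧ ∀ x, R x =ᵐ[μ] T x := by
  have hmem : ∀ x, MemLp (T x) ⊤ μ := fun x =>
    memLp_top_of_bound (hT x) (C * ‖x‖) (Filter.Eventually.of_forall (h x))
  let L : X →ₗ[𝕜] Lp 𝕜 ⊤ μ :=
    { toFun := fun x => (hmem x).toLp (T x)
      map_add' := fun x y => by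
        rw [← MemLp.toLp_add]
        exact MemLp.toLp_congr _ _ (by rw [map_add])
      map_smul' := fun c x => by
        rw [RingHom.id_apply, ← MemLp.toLp_const_smul]
        exact MemLp.toLp_congr _ _ (by rw [map_smul]) }
  have hL : ∀ x, L x =ᵐ[μ] T x := fun x => (hmem x).coeFn_toLp
  refine ⟨L.mkContinuous C fun x => norm_lp_top_le _ (by positivity) ?_,
    LinearMap.mkContinuous_norm_le _ hC _, hL⟩
  filter_upwards [hL x] with ω hω
  rw [hω]
  exact h x ω

/-- The identity of `L_∞(μ)` factors approximately, on finite sets, through finite dimensional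
spaces `ℓ_∞^ι`. -/
theorem exists_approx_lp_top {Ω : Type u} [MeasurableSpace Ω] (μ : Measure Ω) {k : ℕ}
    (f : Fin k → Lp 𝕜 ⊤ μ) {ε : ℝ} (hε : 0 < ε) :
    ∃ (ι : Type u) (_ : Fintype ι) (P : Lp 𝕜 ⊤ μ →L[𝕜] (ι → 𝕜)) (V : (ι → 𝕜) →L[𝕜] Lp 𝕜 ⊤ μ),
      ‖P‖ ≤ 1 ∧ ‖V‖ ≤ 1 ∧ ∀ j, ‖V (P (f j)) - f j‖ ≤ ε := by
  classical
  let X := Fin k → 𝕜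
  let F : Ω → X := fun ω j => f j ω
  have hF : Measurable F := measurable_pi_lambda _ fun j => (Lp.stronglyMeasurable (f j)).measurable
  let r : ℝ := ∑ j, ‖f j‖
  have hFr : ∀ᵐ ω ∂μ, ‖F ω‖ ≤ r := by
    filter_upwards [ae_all_iff.2 fun j => ae_norm_le_norm_lp_top (f j)] with ω hω
    refine (pi_norm_le_iff_of_nonneg (by positivity)).2 fun j => (hω j).trans ?_
    exact Finset.single_le_sum (f := fun j => ‖f j‖) (fun i _ => norm_nonneg _) (Finset.mem_univ j)
  let δ : ℝ := ε / 2
  have hδ : 0 < δ := half_pos hε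
  -- the cells of the partition collect the points where `F` is close to one of finitely many values
  let e : ℕ → X := TopologicalSpace.denseSeq X
  obtain ⟨N, hN⟩ : ∃ N : ℕ, ∀ x : X, ‖x‖ ≤ r → dist (SimpleFunc.nearestPt e N x) x < δ := by
    obtain ⟨t, ht⟩ := (isCompact_closedBall (0 : X) r).elim_finite_subcover
      (fun i => Metric.ball (e i) δ) (fun i => Metric.isOpen_ball) (fun x _ => by
        obtain ⟨i, hi⟩ := (TopologicalSpace.denseRange_denseSeq X).exists_dist_lt x hδ
        exact Set.mem_iUnion.2 ⟨i, hi⟩)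
    refine ⟨t.sup id, fun x hx => ?_⟩
    obtain ⟨i, hi, hxi⟩ := Set.mem_iUnion₂.1 (ht (mem_closedBall_zero_iff.2 hx))
    have h1 := SimpleFunc.edist_nearestPt_le e x (Finset.le_sup (f := id) hi)
    rw [edist_dist, edist_dist, id, ENNReal.ofReal_le_ofReal_iff dist_nonneg] at h1
    exact h1.trans_lt (by rwa [dist_comm])
  let ι := ULift.{u} (Fin (N + 1))
  let cell : Ω → ι := fun ω =>
    ⟨⟨SimpleFunc.nearestPtInd e N (F ω), Nat.lt_succ_of_le (SimpleFunc.nearestPtInd_le e N (F ω))⟩⟩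
  have hcellF : ∀ ω, ‖F ω‖ ≤ r → ‖F ω - e (cell ω).down‖ ≤ δ := fun ω hω => by
    have := (hN (F ω) hω).le
    rw [dist_comm, dist_eq_norm] at this
    exact this
  let A : ι → Set Ω := fun i => cell ⁻¹' {i}
  have hA : ∀ i, MeasurableSet (A i) := fun i => by
    have : A i = F ⁻¹' (SimpleFunc.nearestPtInd e N ⁻¹' {(i.down : ℕ)}) := by
      ext ω
      simp only [A, cell, Set.mem_preimage, Set.mem_singleton_iff]
      rw [← ULift.down_inj, Fin.ext_iff]
    rw [this]
    exact hF ((SimpleFunc.nearestPtInd e N).measurableSet_fiber _)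
  -- a functional on `L_∞` of the cell, of norm at most one, with value one at the constant
  -- function `1` unless the cell is a null set
  have hb : ∀ i, ∃ b : StrongDual 𝕜 (Lp 𝕜 ⊤ (μ.restrict (A i))), ‖b‖ ≤ 1 ∧
      (μ (A i) ≠ 0 → b ((memLp_top_const (1 : 𝕜)).toLp _) = 1) := by
    intro i
    obtain ⟨b, hb1, hb2⟩ := exists_dual_vector'' 𝕜
      ((memLp_top_const (1 : 𝕜)).toLp (μ := μ.restrict (A i)) _)
    refine ⟨b, hb1, fun hi => ?_⟩
    have hne : μ.restrict (A i) ≠ 0 := fun h0 => hi (Measure.restrict_eq_zero.1 h0)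
    rw [hb2, Lp.norm_toLp, eLpNorm_const _ (by simp) hne]
    simp
  choose b hb1 hb2 using hb
  let res := fun i => LpToLpRestrictCLM Ω 𝕜 𝕜 μ ⊤ (A i)
  have hres : ∀ i, ‖res i‖ ≤ 1 := fun i =>
    (res i).opNorm_le_bound zero_le_one fun g => by
      rw [one_mul]; exact norm_Lp_toLp_restrict_le (A i) g
  let P : Lp 𝕜 ⊤ μ →L[𝕜] (ι → 𝕜) := ContinuousLinearMap.pi fun i => (b i).comp (res i)
  have hP : ‖P‖ ≤ 1 := by
    refine ContinuousLinearMap.opNorm_le_bound _ zero_le_one fun g => ?_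
    refine (pi_norm_le_iff_of_nonneg (by positivity)).2 fun i => ?_
    exact (b i).le_of_opNorm_le_of_le (hb1 i) ((res i).le_of_opNorm_le (hres i) g) |>.trans
      (by simp)
  obtain ⟨V, hV1, hV2⟩ := exists_clm_lp_top (X := ι → 𝕜) (𝕜 := 𝕜) μ
    (LinearMap.funLeft 𝕜 𝕜 cell) (fun t => by
      have hcell : Measurable cell := measurable_to_countable' hA
      exact ((measurable_of_countable t).comp hcell).aestronglyMeasurable)
    zero_le_one (fun t ω => by
      rw [one_mul]; exact norm_le_pi_norm t (cell ω))
  refine ⟨ι, inferInstance, P, V, hP, hV1, fun j => norm_lp_top_le _ hε.le ?_⟩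
  have hcoord : ∀ i, μ (A i) ≠ 0 → ‖P (f j) i - e i.down j‖ ≤ δ := by
    intro i hi
    let one := (memLp_top_const (1 : 𝕜)).toLp (μ := μ.restrict (A i)) _
    have h1 : P (f j) i - e i.down j = b i (res i (f j) - (e i.down j) • one) := by
      rw [map_sub, map_smul, hb2 i hi]
      simp [P]
    have h2 : ‖res i (f j) - (e i.down j) • one‖ ≤ δ := by
      refine norm_lp_top_le _ hδ.le ?_
      filter_upwards [Lp.coeFn_sub (res i (f j)) ((e i.down j) • one),
        Lp.coeFn_smul (e i.down j) one,
        (memLp_top_const (1 : 𝕜)).coeFn_toLp (μ := μ.restrict (A i)),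
        LpToLpRestrictCLM_coeFn 𝕜 (A i) (f j), ae_restrict_of_ae hFr, ae_restrict_mem (hA i)]
        with ω h3 h4 h5 h6 h7 h8
      rw [h3, Pi.sub_apply, h4, Pi.smul_apply, h5, h6, smul_eq_mul, mul_one]
      have h9 := (norm_le_pi_norm _ j).trans (hcellF ω h7)
      have h10 : cell ω = i := h8
      rwa [h10] at h9
    rw [h1]
    exact (b i).le_of_opNorm_le_of_le (hb1 i) h2 |>.trans (by simp)
  have hnull : ∀ i, μ (A i) = 0 → ∀ᵐ ω ∂μ, cell ω ≠ i := fun i hi => by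
    rw [ae_iff]; simp only [not_not]; exact hi
  have hcell0 : ∀ᵐ ω ∂μ, μ (A (cell ω)) ≠ 0 := by
    filter_upwards [ae_all_iff.2 fun i => ae_all_iff.2 fun hi => hnull i hi] with ω hω h0
    exact hω _ h0 rfl
  filter_upwards [Lp.coeFn_sub (V (P (f j))) (f j), hV2 (P (f j)), hFr, hcell0] with ω h1 h2 h3 h4
  rw [h1, Pi.sub_apply, h2, LinearMap.funLeft_apply]
  have h5 := hcoord _ h4
  have h6 := (norm_le_pi_norm _ j).trans (hcellF ω h3)
  have h7 : P (f j) (cell ω) - f j ω =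
      (P (f j) (cell ω) - e (cell ω).down.val j) - (F ω - e (cell ω).down.val) j := by
    rw [Pi.sub_apply (F ω), sub_sub_sub_cancel_right]
  rw [h7]
  exact (norm_sub_le _ _).trans ((add_le_add h5 h6).trans (add_halves ε).le)

theorem norm_lp_one_eq {Ω : Type*} [MeasurableSpace Ω] {μ : Measure Ω} (f : Lp 𝕜 1 μ) :
    ‖f‖ = ∫ ω, ‖f ω‖ ∂μ := L1.norm_eq_integral_norm f

/-- An operator on `ℓ_1^ι` given by the images of the unit vectors. -/
theorem exists_clm_piLp_one {X : Type*} [NormedAddCommGroup X] [NormedSpace 𝕜 X] {ι : Type*}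
    [Fintype ι] (x : ι → X) {C : ℝ} (hC : 0 ≤ C) (hx : ∀ i, ‖x i‖ ≤ C) :
    ∃ V : PiLp 1 (fun _ : ι => 𝕜) →L[𝕜] X, ‖V‖ ≤ C ∧ ∀ t, V t = ∑ i, t i • x i := by
  let L : PiLp 1 (fun _ : ι => 𝕜) →ₗ[𝕜] X :=
    { toFun := fun t => ∑ i, t i • x i
      map_add' := fun s t => by simp [add_smul, Finset.sum_add_distrib]
      map_smul' := fun c t => by simp [mul_smul, Finset.smul_sum] }
  refine ⟨L.mkContinuous C fun t => ?_, LinearMap.mkContinuous_norm_le _ hC _, fun t => rfl⟩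
  rw [PiLp.norm_eq_of_L1, Finset.mul_sum]
  refine (norm_sum_le _ _).trans (Finset.sum_le_sum fun i _ => ?_)
  rw [norm_smul, mul_comm]
  exact mul_le_mul_of_nonneg_right (hx i) (norm_nonneg _)

/-- The identity of `L_1(μ)` factors approximately, on finite sets, through finite dimensional
spaces `ℓ_1^ι`, by means of conditional expectations. -/
theorem exists_approx_lp_one {Ω : Type u} [MeasurableSpace Ω] (μ : Measure Ω) {k : ℕ}
    (f : Fin k → Lp 𝕜 1 μ) {ε : ℝ} (hε : 0 < ε) :
    ∃ (ι : Type u) (_ : Fintype ι) (P : Lp 𝕜 1 μ →L[𝕜] PiLp 1 (fun _ : ι => 𝕜))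
      (V : PiLp 1 (fun _ : ι => 𝕜) →L[𝕜] Lp 𝕜 1 μ),
      ‖P‖ ≤ 1 ∧ ‖V‖ ≤ 1 ∧ ∀ j, ‖V (P (f j)) - f j‖ ≤ ε := by
  classical
  let X := Fin k → 𝕜
  let F : Ω → X := fun ω j => f j ω
  have hF : MemLp F 1 μ := memLp_pi_iff.2 fun j => Lp.memLp (f j)
  obtain ⟨g, hg1, hg2⟩ := hF.exists_simpleFunc_eLpNorm_sub_lt ENNReal.one_ne_top
    (ε := ENNReal.ofReal (ε / 2)) (by simpa using hε)
  let s : Finset X := g.range.filter (· ≠ 0)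
  let ι := ULift.{u} s
  let A : ι → Set Ω := fun i => g ⁻¹' {i.down.1}
  have hA : ∀ i, MeasurableSet (A i) := fun i => g.measurableSet_fiber _
  have hAμ : ∀ i, μ (A i) ≠ ∞ := fun i =>
    (SimpleFunc.measure_preimage_lt_top_of_memLp one_ne_zero ENNReal.one_ne_top g hg2 _
      (Finset.mem_filter.1 i.down.2).2).ne
  have hdisj : Pairwise (Function.onFun Disjoint A) := fun i i' hii => by
    refine Set.disjoint_left.2 fun ω h1 h2 => hii ?_
    rw [← ULift.down_inj, Subtype.ext_iff]
    exact (Set.mem_singleton_iff.1 h1).symm.trans (Set.mem_singleton_iff.1 h2)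
  have hint : ∀ h : Lp 𝕜 1 μ, Integrable h μ := fun h => L1.integrable_coeFn h
  let PL : Lp 𝕜 1 μ →ₗ[𝕜] PiLp 1 (fun _ : ι => 𝕜) :=
    { toFun := fun h => WithLp.toLp 1 fun i => ∫ ω in A i, h ω ∂μ
      map_add' := fun h h' => by
        ext i
        simp only [PiLp.add_apply]
        rw [← integral_add (hint h).integrableOn (hint h').integrableOn]
        exact integral_congr_ae (ae_restrict_of_ae (Lp.coeFn_add h h'))
      map_smul' := fun c h => by
        ext i
        simp only [PiLp.smul_apply, RingHom.id_apply]
        rw [← integral_smul]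
        exact integral_congr_ae (ae_restrict_of_ae (Lp.coeFn_smul c h)) }
  have hPL : ∀ h, ‖PL h‖ ≤ 1 * ‖h‖ := fun h => by
    rw [one_mul, PiLp.norm_eq_of_L1, norm_lp_one_eq]
    refine (Finset.sum_le_sum fun i _ =>
      norm_integral_le_integral_norm (μ := μ.restrict (A i)) (fun ω => h ω)).trans ?_
    rw [← integral_iUnion_fintype hA hdisj fun i => (hint h).norm.integrableOn]
    exact setIntegral_le_integral (hint h).norm (Filter.Eventually.of_forall fun ω => norm_nonneg _)
  let P := PL.mkContinuous 1 hPL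
  have hP : ‖P‖ ≤ 1 := LinearMap.mkContinuous_norm_le _ zero_le_one _
  let ind : ι → Lp 𝕜 1 μ := fun i => indicatorConstLp 1 (hA i) (hAμ i) (1 : 𝕜)
  have hind : ∀ i, ‖ind i‖ = μ.real (A i) := fun i => by
    simp [ind, norm_indicatorConstLp]
  obtain ⟨V, hV1, hV2⟩ := exists_clm_piLp_one (𝕜 := 𝕜)
    (fun i => ((μ.real (A i))⁻¹ : 𝕜) • ind i) zero_le_one (fun i => by
      rw [norm_smul, norm_inv, RCLike.norm_ofReal, abs_of_nonneg measureReal_nonneg, hind]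
      exact inv_mul_le_one)
  have hVP : ∀ i, V (P (ind i)) = ind i := fun i => by
    have h1 : ∀ i', P (ind i) i' = if i' = i then (μ.real (A i) : 𝕜) else 0 := fun i' => by
      have : P (ind i) i' = ∫ ω in A i', ind i ω ∂μ := rfl
      rw [this, setIntegral_indicatorConstLp (hA i')]
      split_ifs with h
      · subst h
        simp [Algebra.smul_def]
      · rw [(hdisj (Ne.symm h)).inter_eq]
        simp
    rw [hV2]
    rw [Finset.sum_eq_single i (fun i' _ hi' => by rw [h1, if_neg hi', zero_smul]) (by simp),
      h1, if_pos rfl, smul_smul]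
    by_cases h0 : μ.real (A i) = 0
    · have : ind i = 0 := by rw [← norm_eq_zero, hind, h0]
      rw [this, smul_zero]
    · rw [mul_inv_cancel₀ (by exact_mod_cast h0), one_smul]
  refine ⟨ι, inferInstance, P, V, hP, hV1, fun j => ?_⟩
  let h : Lp 𝕜 1 μ := ∑ i, (i.down.1 j) • ind i
  have hh : ∀ᵐ ω ∂μ, h ω = g ω j := by
    filter_upwards [Lp.coeFn_finsetSum Finset.univ fun i : ι => (i.down.1 j) • ind i,
      ae_all_iff.2 fun i : ι => Lp.coeFn_smul (i.down.1 j) (ind i),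
      ae_all_iff.2 fun i : ι => indicatorConstLp_coeFn (p := 1) (hs := hA i) (hμs := hAμ i)
        (c := (1 : 𝕜))] with ω h1 h2 h3
    rw [h1, Finset.sum_apply]
    have h4 : ∀ i : ι, (((i.down.1 j) • ind i : Lp 𝕜 1 μ) : Ω → 𝕜) ω =
        if g ω = i.down.1 then g ω j else 0 := fun i => by
      rw [h2, Pi.smul_apply, h3, Set.indicator_apply]
      simp only [A, Set.mem_preimage, Set.mem_singleton_iff]
      split_ifs with h5
      · simp [h5]
      · simp
    simp only [h4]
    by_cases h0 : g ω = 0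
    · have h5 : g ω j = 0 := by rw [h0]; rfl
      simp only [h5, ite_self, Finset.sum_const_zero]
    · rw [Finset.sum_eq_single (⟨⟨g ω, Finset.mem_filter.2 ⟨g.mem_range_self ω, h0⟩⟩⟩ : ι)]
      · simp
      · intro i _ hi
        rw [if_neg fun h5 => hi ?_]
        rw [← ULift.down_inj, Subtype.ext_iff, ← h5]
      · simp
  have hfh : ‖f j - h‖ ≤ ε / 2 := by
    rw [Lp.norm_def]
    refine ENNReal.toReal_le_of_le_ofReal (by positivity) (le_trans ?_ hg1.le)
    refine eLpNorm_mono_ae ?_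
    filter_upwards [Lp.coeFn_sub (f j) h, hh] with ω h1 h2
    rw [h1, Pi.sub_apply, h2]
    exact norm_le_pi_norm ((F - g) ω) j
  have hVh : V (P h) = h := by
    simp only [h, map_sum, map_smul, hVP]
  have hdecomp : V (P (f j)) - f j = V (P (f j - h)) - (f j - h) := by
    rw [map_sub, map_sub, hVh]; abel
  rw [hdecomp]
  have h1 : ‖V (P (f j - h))‖ ≤ ε / 2 :=
    (V.le_of_opNorm_le_of_le hV1 (P.le_of_opNorm_le_of_le hP hfh)).trans (by simp)
  exact (norm_sub_le _ _).trans (by linarith)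

/-- The identity of `ℓ_1(S)` factors approximately, on finite sets, through finite dimensional
spaces `ℓ_1^ι`, by truncation. -/
theorem exists_approx_little_lp_one {S : Type u} {k : ℕ} (f : Fin k → lp (fun _ : S => 𝕜) 1)
    {ε : ℝ} (hε : 0 < ε) :
    ∃ (ι : Type u) (_ : Fintype ι) (P : lp (fun _ : S => 𝕜) 1 →L[𝕜] PiLp 1 (fun _ : ι => 𝕜))
      (V : PiLp 1 (fun _ : ι => 𝕜) →L[𝕜] lp (fun _ : S => 𝕜) 1),
      ‖P‖ ≤ 1 ∧ ‖V‖ ≤ 1 ∧ ∀ j, ‖V (P (f j)) - f j‖ ≤ ε := by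
  classical
  have hlim : ∀ᶠ A : Finset S in Filter.atTop, ∀ j,
      ‖∑ s ∈ A, lp.single (E := fun _ : S => 𝕜) 1 s (f j s) - f j‖ < ε :=
    Filter.eventually_all.2 fun j => by
      have := (lp.hasSum_single ENNReal.one_ne_top (f j)).eventually (Metric.ball_mem_nhds (f j) hε)
      filter_upwards [this] with A hA
      simpa [dist_eq_norm] using hA
  obtain ⟨A, hA⟩ := hlim.exists
  let ι := {s : S // s ∈ A}
  let PL : lp (fun _ : S => 𝕜) 1 →ₗ[𝕜] PiLp 1 (fun _ : ι => 𝕜) :=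
    { toFun := fun h => WithLp.toLp 1 fun i => h i.1
      map_add' := fun h h' => by ext i; simp
      map_smul' := fun c h => by ext i; simp }
  have hPL : ∀ h, ‖PL h‖ ≤ 1 * ‖h‖ := fun h => by
    rw [one_mul, PiLp.norm_eq_of_L1]
    have := lp.sum_rpow_le_norm_rpow (p := 1) (by simp) h A
    simp only [ENNReal.toReal_one, Real.rpow_one] at this
    rw [← Finset.sum_coe_sort] at this
    exact this
  obtain ⟨V, hV1, hV2⟩ := exists_clm_piLp_one (𝕜 := 𝕜)
    (fun i : ι => lp.single (E := fun _ : S => 𝕜) 1 i.1 1) zero_le_one (fun i => by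
      rw [lp.norm_single zero_lt_one]; simp)
  refine ⟨ι, inferInstance, PL.mkContinuous 1 hPL, V,
    LinearMap.mkContinuous_norm_le _ zero_le_one _, hV1, fun j => ?_⟩
  have h1 : V (PL.mkContinuous 1 hPL (f j)) =
      ∑ s ∈ A, lp.single (E := fun _ : S => 𝕜) 1 s (f j s) := by
    rw [hV2, ← Finset.sum_coe_sort A]
    refine Finset.sum_congr rfl fun i _ => ?_
    rw [← lp.single_smul]
    simp [PL]
  rw [h1]
  exact (hA j).le

/-- If `J T = S R` with `R : E → L`, `S : L → F''`, and the identity of `L` factors approximately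
through a finite dimensional space `W`, then `T` itself factors approximately through `W`. -/
theorem exists_approx_factorization {E F L W : Type*} [NormedAddCommGroup E] [NormedSpace 𝕜 E]
    [NormedAddCommGroup F] [NormedSpace 𝕜 F] [NormedAddCommGroup L] [NormedSpace 𝕜 L]
    [NormedAddCommGroup W] [NormedSpace 𝕜 W] [FiniteDimensional 𝕜 W] (T : E →L[𝕜] F)
    (R : E →L[𝕜] L) (S : L →L[𝕜] StrongDual 𝕜 (StrongDual 𝕜 F))
    (hSR : ∀ x, S (R x) = NormedSpace.inclusionInDoubleDual 𝕜 F (T x)) (P : L →L[𝕜] W)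
    (V : W →L[𝕜] L) (hV : ‖V‖ ≤ 1) {k : ℕ} (x : Fin k → E) {ε : ℝ} (hε : 0 < ε)
    (h : ∀ j, ‖V (P (R (x j))) - R (x j)‖ ≤ ε / 2 / (‖S‖ + 1)) :
    ∃ S' : W →L[𝕜] F, ‖S'‖ ≤ ‖S‖ + ε ∧ ∀ j, ‖S' (P (R (x j))) - T (x j)‖ ≤ ε := by
  obtain ⟨S', h1, h2⟩ := exists_continuousLinearMap_of_bidual (S.comp V)
    (fun j => P (R (x j))) (fun j => T (x j)) (ε / 2) (fun j => by
      rw [← hSR, ContinuousLinearMap.comp_apply, ← map_sub]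
      refine (S.le_of_opNorm_le_of_le le_rfl (h j)).trans ?_
      rw [mul_div_assoc']
      rw [div_le_iff₀ (by positivity)]
      nlinarith [norm_nonneg S]) (half_pos hε)
  refine ⟨S', h1.trans ?_, fun j => (h2 j).trans (by linarith)⟩
  have : ‖S.comp V‖ ≤ ‖S‖ :=
    (S.opNorm_comp_le V).trans (mul_le_of_le_one_right (norm_nonneg _) hV)
  linarith

end Approximation

/-! ### General facts on s-tensor norms and their polynomials -/

section General

variable {𝕜 : Type} [RCLike 𝕜] {n : ℕ} {E F : Type u} [NormedAddCommGroup E] [NormedSpace 𝕜 E]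
  [NormedAddCommGroup F] [NormedSpace 𝕜 F]

theorem bddAbove_epsNorm_set (z : symTensor 𝕜 n E) :
    BddAbove {r : ℝ | ∃ φ : StrongDual 𝕜 E, ‖φ‖ ≤ 1 ∧ r = ‖powFunctional n φ.toLinearMap z‖} := by
  obtain ⟨m, c, x, rfl⟩ := exists_sum_symPow z
  refine ⟨∑ j, ‖c j‖ * ‖x j‖ ^ n, ?_⟩
  rintro _ ⟨φ, hφ, rfl⟩
  rw [map_sum]
  refine (norm_sum_le _ _).trans (Finset.sum_le_sum fun j _ => ?_)
  rw [map_smul, powFunctional_symPow, smul_eq_mul, norm_mul, norm_pow]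
  refine mul_le_mul_of_nonneg_left (pow_le_pow_left₀ (norm_nonneg _) ?_ n) (norm_nonneg _)
  simpa using φ.le_of_opNorm_le hφ (x j)

theorem exists_extension_strongDual (J : E →ₗᵢ[𝕜] F) (φ : StrongDual 𝕜 E) :
    ∃ ψ : StrongDual 𝕜 F, (∀ x, ψ (J x) = φ x) ∧ ‖ψ‖ ≤ ‖φ‖ := by
  obtain ⟨ψ, h1, h2⟩ := exists_extension_of_injective (j := J.toLinearMap) J.injective
    (normSeminorm 𝕜 F) ‖φ‖₊ φ.toLinearMap (fun x => by simpa using φ.le_opNorm x)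
  exact ⟨ψ.mkContinuous ‖φ‖ h2, h1, LinearMap.mkContinuous_norm_le _ (norm_nonneg _) _⟩

theorem epsNorm_le_epsNorm_symMap (J : E →ₗᵢ[𝕜] F) (z : symTensor 𝕜 n E) :
    epsNorm n z ≤ epsNorm n (symMap n J.toLinearMap z) := by
  refine csSup_le ⟨_, 0, by simp, rfl⟩ ?_
  rintro _ ⟨φ, hφ, rfl⟩
  obtain ⟨ψ, h1, h2⟩ := exists_extension_strongDual J φ
  refine le_csSup (bddAbove_epsNorm_set _) ⟨ψ, h2.trans hφ, ?_⟩
  rw [powFunctional_symMap]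
  congr 3
  ext x
  exact (h1 x).symm

theorem bddBelow_piNorm_set (z : symTensor 𝕜 n E) :
    BddBelow {r : ℝ | ∃ (m : ℕ) (c : Fin m → 𝕜) (x : Fin m → E),
      z = ∑ j, c j • symPow 𝕜 n (x j) ∧ r = ∑ j, ‖c j‖ * ‖x j‖ ^ n} :=
  ⟨0, by rintro _ ⟨m, c, x, -, rfl⟩; positivity⟩

theorem piNorm_sum_le {m : ℕ} (c : Fin m → 𝕜) (x : Fin m → E) :
    piNorm n (∑ j, c j • symPow 𝕜 n (x j)) ≤ ∑ j, ‖c j‖ * ‖x j‖ ^ n :=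
  csInf_le (bddBelow_piNorm_set _) ⟨m, c, x, rfl, rfl⟩

theorem piNorm_symPow_le (x : E) : piNorm n (symPow 𝕜 n x) ≤ ‖x‖ ^ n := by
  have := piNorm_sum_le (n := n) (fun _ : Fin 1 => (1 : 𝕜)) fun _ => x
  simpa using this

/-- To bound a quantity by `π_{n,s}(z)` it suffices to bound it by every representation of `z`. -/
theorem le_piNorm {z : symTensor 𝕜 n E} {a : ℝ}
    (h : ∀ (m : ℕ) (c : Fin m → 𝕜) (x : Fin m → E), z = ∑ j, c j • symPow 𝕜 n (x j) →
      a ≤ ∑ j, ‖c j‖ * ‖x j‖ ^ n) : a ≤ piNorm n z := by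
  obtain ⟨m, c, x, hz⟩ := exists_sum_symPow z
  refine le_csInf ⟨_, m, c, x, hz, rfl⟩ ?_
  rintro _ ⟨m, c, x, hz, rfl⟩
  exact h m c x hz

theorem piNorm_symMap_le (T : E →L[𝕜] F) (hT : ‖T‖ ≤ 1) (z : symTensor 𝕜 n E) :
    piNorm n (symMap n T.toLinearMap z) ≤ piNorm n z := by
  refine le_piNorm fun m c x hz => ?_
  rw [hz, symMap_sum]
  refine (piNorm_sum_le _ _).trans (Finset.sum_le_sum fun j _ => ?_)
  refine mul_le_mul_of_nonneg_left (pow_le_pow_left₀ (norm_nonneg _) ?_ n) (norm_nonneg _)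
  simpa using T.le_of_opNorm_le hT (x j)

variable [CompleteSpace E] [CompleteSpace F]

theorem STensorNorm.norm_symMap_le (β : STensorNorm.{u} 𝕜 n) (T : E →L[𝕜] F) {C : ℝ}
    (hT : ‖T‖ ≤ C) (z : symTensor 𝕜 n E) :
    β.norm F (symMap n T.toLinearMap z) ≤ C ^ n * β.norm E z :=
  (β.map_le E F T z).trans (mul_le_mul_of_nonneg_right
    (pow_le_pow_left₀ (norm_nonneg _) hT n) (apply_nonneg _ z))

theorem STensorNorm.norm_symMap_le_of_le_one (β : STensorNorm.{u} 𝕜 n) (T : E →L[𝕜] F)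
    (hT : ‖T‖ ≤ 1) (z : symTensor 𝕜 n E) :
    β.norm F (symMap n T.toLinearMap z) ≤ β.norm E z := by
  simpa using β.norm_symMap_le T hT z

/-- A functional which is bounded for an s-tensor norm linearizes a continuous polynomial. -/
theorem STensorNorm.exists_homPoly (β : STensorNorm.{u} 𝕜 n) (φ : symTensor 𝕜 n E →ₗ[𝕜] 𝕜)
    (C : ℝ≥0) (h : ∀ z, ‖φ z‖ ≤ C * β.norm E z) : ∃ q : HomPoly 𝕜 n E, q.functional = φ :=
  SymTensorNorms.exists_homPoly φ C C.2 fun x => (h _).trans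
    (mul_le_mul_of_nonneg_left ((β.le_pi E _).trans (piNorm_symPow_le x)) C.2)

theorem enorm_le_one_of_norm_le_one {X : Type*} [SeminormedAddCommGroup X] {x : X} (h : ‖x‖ ≤ 1) :
    ‖x‖ₑ ≤ 1 := by
  rw [← ofReal_norm]
  exact ENNReal.ofReal_le_one.2 h

theorem le_mul_sInf_pow {a C : ℝ≥0∞} (hC : C ≠ ∞) {s : Set ℝ≥0∞} (hs : sInf s ≠ ∞)
    (h : ∀ r ∈ s, a ≤ C * r ^ n) : a ≤ C * sInf s ^ n := by
  have hlim : Tendsto (fun r => C * r ^ n) (𝓝[>] (sInf s)) (𝓝 (C * sInf s ^ n)) :=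
    (((ENNReal.continuous_const_mul hC).comp (ENNReal.continuous_pow n)).tendsto _).mono_left
      nhdsWithin_le_nhds
  have : (𝓝[>] (sInf s)).NeBot := nhdsGT_neBot_of_exists_gt ⟨∞, lt_top_iff_ne_top.2 hs⟩
  refine ge_of_tendsto hlim ?_
  filter_upwards [self_mem_nhdsWithin] with r hr
  obtain ⟨r', hr', hlt⟩ := sInf_lt_iff.1 (Set.mem_Ioi.1 hr)
  exact (h r' hr').trans (by gcongr)

end General

/-! ### The space `ℓ_∞` and its extension property -/

section LInf

variable {𝕜 : Type} [RCLike 𝕜] {n : ℕ} {E F : Type u} [NormedAddCommGroup E] [NormedSpace 𝕜 E]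
  [NormedAddCommGroup F] [NormedSpace 𝕜 F]

variable (𝕜) in
/-- The space `ℓ_∞(S)`, as the `L_∞` space of the counting measure on the discrete space `S`. -/
abbrev LInf (S : Type u) [MeasurableSpace S] : Type u :=
  Lp 𝕜 ⊤ (Measure.count : Measure S)

variable {S : Type u} [MeasurableSpace S]

theorem exists_clm_linf_of_family [DiscreteMeasurableSpace S] (a : S → StrongDual 𝕜 E) {C : ℝ}
    (hC : 0 ≤ C) (ha : ∀ s, ‖a s‖ ≤ C) :
    ∃ R : E →L[𝕜] LInf 𝕜 S, ‖R‖ ≤ C ∧ ∀ x s, R x s = a s x := by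
  obtain ⟨R, h1, h2⟩ := exists_clm_lp_top (Measure.count : Measure S)
    (LinearMap.pi fun s => (a s).toLinearMap)
    (fun x => (Measurable.of_discrete).aestronglyMeasurable) hC
    (fun x s => (a s).le_of_opNorm_le (ha s) x)
  exact ⟨R, h1, fun x s => Measure.ae_count_iff.1 (h2 x) s⟩

theorem linf_apply_le_norm (f : LInf 𝕜 S) (s : S) : ‖f s‖ ≤ ‖f‖ :=
  Measure.ae_count_iff.1 (ae_norm_le_norm_lp_top f) s

/-- Evaluation at a point of `S` on `ℓ_∞(S)`. -/
def linfEval (s : S) : StrongDual 𝕜 (LInf 𝕜 S) :=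
  LinearMap.mkContinuous
    { toFun := fun f => f s
      map_add' := fun f g => Measure.ae_count_iff.1 (Lp.coeFn_add f g) s
      map_smul' := fun c f => Measure.ae_count_iff.1 (Lp.coeFn_smul c f) s } 1
    fun f => (linf_apply_le_norm f s).trans_eq (one_mul _).symm

theorem linfEval_apply (s : S) (f : LInf 𝕜 S) : linfEval s f = f s := rfl

theorem norm_linfEval_le (s : S) : ‖(linfEval s : StrongDual 𝕜 (LInf 𝕜 S))‖ ≤ 1 :=
  LinearMap.mkContinuous_norm_le _ zero_le_one _

theorem linf_ext {f g : LInf 𝕜 S} (h : ∀ s, f s = g s) : f = g :=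
  Lp.ext (Measure.ae_count_iff.2 h)

/-- The metric extension property of `ℓ_∞(S)`. -/
theorem exists_extension_linf [DiscreteMeasurableSpace S] (J : E →ₗᵢ[𝕜] F) (T : E →L[𝕜] LInf 𝕜 S) :
    ∃ T' : F →L[𝕜] LInf 𝕜 S, (∀ x, T' (J x) = T x) ∧ ‖T'‖ ≤ ‖T‖ := by
  have hext : ∀ s : S, ∃ ψ : StrongDual 𝕜 F, (∀ x, ψ (J x) = T x s) ∧ ‖ψ‖ ≤ ‖T‖ := fun s => by
    obtain ⟨ψ, h1, h2⟩ := exists_extension_strongDual J ((linfEval s).comp T)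
    have h3 : ‖(linfEval s).comp T‖ ≤ ‖T‖ := (ContinuousLinearMap.opNorm_comp_le _ T).trans
      (mul_le_of_le_one_left (norm_nonneg _) (norm_linfEval_le s))
    refine ⟨ψ, fun x => ?_, h2.trans h3⟩
    rw [h1, ContinuousLinearMap.comp_apply, linfEval_apply]
  choose a ha1 ha2 using hext
  obtain ⟨R, h1, h2⟩ := exists_clm_linf_of_family a (norm_nonneg T) ha2
  exact ⟨R, fun x => linf_ext fun s => by rw [h2, ha1], h1⟩

/-- The metric extension property of `ℓ_∞^ι` for finite `ι`. -/
theorem exists_extension_pi {ι : Type*} [Fintype ι] (J : E →ₗᵢ[𝕜] F) (T : E →L[𝕜] (ι → 𝕜)) :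
    ∃ T' : F →L[𝕜] (ι → 𝕜), (∀ x, T' (J x) = T x) ∧ ‖T'‖ ≤ ‖T‖ := by
  choose a ha1 ha2 using fun i => exists_extension_strongDual J
    ((ContinuousLinearMap.proj (R := 𝕜) (φ := fun _ : ι => 𝕜) i).comp T)
  refine ⟨ContinuousLinearMap.pi a, fun x => funext fun i => by simp [ha1], ?_⟩
  refine ContinuousLinearMap.opNorm_le_bound _ (norm_nonneg _) fun y => ?_
  refine (pi_norm_le_iff_of_nonneg (by positivity)).2 fun i => (a i).le_of_opNorm_le ?_ y
  refine (ha2 i).trans (ContinuousLinearMap.opNorm_le_bound _ (norm_nonneg _) fun x => ?_)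
  exact (norm_le_pi_norm _ i).trans (T.le_opNorm x)

variable (𝕜 E) in
/-- The unit ball of the dual of `E`, as a discrete measurable space. -/
def DualBall : Type u := {φ : StrongDual 𝕜 E // ‖φ‖ ≤ 1}

instance : MeasurableSpace (DualBall 𝕜 E) := ⊤

instance : DiscreteMeasurableSpace (DualBall 𝕜 E) := ⟨fun _ => trivial⟩

theorem exists_dualEmbedding :
    ∃ I : E →ₗᵢ[𝕜] LInf 𝕜 (DualBall 𝕜 E), ∀ x φ, I x φ = φ.1 x := by
  obtain ⟨R, h1, h2⟩ := exists_clm_linf_of_family (S := DualBall 𝕜 E) (fun φ => φ.1)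
    zero_le_one (fun φ => φ.2)
  refine ⟨⟨R.toLinearMap, fun x => le_antisymm ?_ ?_⟩, h2⟩
  · simpa using R.le_of_opNorm_le h1 x
  · obtain ⟨φ, hφ, hx⟩ := exists_dual_vector'' 𝕜 x
    have h3 : R x (⟨φ, hφ⟩ : DualBall 𝕜 E) = φ x := h2 x _
    have h4 := linf_apply_le_norm (R x) (⟨φ, hφ⟩ : DualBall 𝕜 E)
    rw [h3, hx] at h4
    simpa using h4

variable (𝕜 E) in
/-- The canonical isometric embedding of `E` into `ℓ_∞` of the unit ball of its dual. -/
def dualEmbedding : E →ₗᵢ[𝕜] LInf 𝕜 (DualBall 𝕜 E) :=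
  exists_dualEmbedding.choose

end LInf

/-! ### The injective hull -/

section InjectiveHull

variable {𝕜 : Type} [RCLike 𝕜] {n : ℕ}

/-- The norm `β(⊗ⁿ I z; ℓ_∞(B_{E'}))` for the canonical embedding `I` of `E`. -/
def injHullNorm (β : STensorNorm.{u} 𝕜 n) (E : Type u) [NormedAddCommGroup E] [NormedSpace 𝕜 E] :
    Seminorm 𝕜 (symTensor 𝕜 n E) :=
  (β.norm (LInf 𝕜 (DualBall 𝕜 E))).comp (symMap n (dualEmbedding 𝕜 E).toLinearMap)

theorem injHullNorm_apply (β : STensorNorm.{u} 𝕜 n) {E : Type u} [NormedAddCommGroup E]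
    [NormedSpace 𝕜 E] (z : symTensor 𝕜 n E) : injHullNorm β E z =
      β.norm (LInf 𝕜 (DualBall 𝕜 E)) (symMap n (dualEmbedding 𝕜 E).toLinearMap z) := rfl

variable {E F : Type u} [NormedAddCommGroup E] [NormedSpace 𝕜 E] [NormedAddCommGroup F]
  [NormedSpace 𝕜 F]

/-- If `T : E → F` extends to an operator `T'` on `ℓ_∞(B_{E'})`, then the `β`-norm of `⊗ⁿ T z` is
controlled by `‖T'‖` and the hull norm of `z`. -/
theorem norm_symMap_le_injHullNorm [CompleteSpace F] (β : STensorNorm.{u} 𝕜 n) (T : E →L[𝕜] F)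
    (T' : LInf 𝕜 (DualBall 𝕜 E) →L[𝕜] F) (h : ∀ x, T' (dualEmbedding 𝕜 E x) = T x) {C : ℝ}
    (hC : ‖T'‖ ≤ C) (z : symTensor 𝕜 n E) :
    β.norm F (symMap n T.toLinearMap z) ≤ C ^ n * injHullNorm β E z := by
  have : T.toLinearMap = T'.toLinearMap ∘ₗ (dualEmbedding 𝕜 E).toLinearMap := by
    ext x
    exact (h x).symm
  rw [this, ← symMap_comp_apply]
  exact β.norm_symMap_le T' hC _

theorem injHullNorm_map_le (β : STensorNorm.{u} 𝕜 n) (T : E →L[𝕜] F) (z : symTensor 𝕜 n E) :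
    injHullNorm β F (symMap n T.toLinearMap z) ≤ ‖T‖ ^ n * injHullNorm β E z := by
  obtain ⟨T', h1, h2⟩ := exists_extension_linf (dualEmbedding 𝕜 E)
    ((dualEmbedding 𝕜 F).toContinuousLinearMap.comp T)
  rw [injHullNorm_apply, symMap_comp_apply]
  refine norm_symMap_le_injHullNorm β _ T' h1 (h2.trans ?_) z
  refine ContinuousLinearMap.opNorm_le_bound _ (norm_nonneg _) fun x => ?_
  simpa using T.le_opNorm x

theorem injHullNorm_symMap_isometry (β : STensorNorm.{u} 𝕜 n) (J : E →ₗᵢ[𝕜] F)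
    (z : symTensor 𝕜 n E) : injHullNorm β F (symMap n J.toLinearMap z) = injHullNorm β E z := by
  apply le_antisymm
  · refine (injHullNorm_map_le β J.toContinuousLinearMap z).trans ?_
    exact mul_le_of_le_one_left (apply_nonneg _ z)
      (pow_le_one₀ (norm_nonneg _) J.norm_toContinuousLinearMap_le)
  · obtain ⟨T, h1, h2⟩ := exists_extension_linf ((dualEmbedding 𝕜 F).comp J)
      (dualEmbedding 𝕜 E).toContinuousLinearMap
    have hT : T.toLinearMap ∘ₗ (dualEmbedding 𝕜 F).toLinearMap ∘ₗ J.toLinearMap =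
        (dualEmbedding 𝕜 E).toLinearMap := by
      ext x : 1
      exact h1 x
    rw [injHullNorm_apply, injHullNorm_apply, ← hT, ← symMap_comp_apply, ← symMap_comp_apply]
    exact β.norm_symMap_le_of_le_one T
      (h2.trans (dualEmbedding 𝕜 E).norm_toContinuousLinearMap_le) _

/-- The injective hull of an s-tensor norm. -/
def injHull (β : STensorNorm.{u} 𝕜 n) : STensorNorm.{u} 𝕜 n where
  norm E _ _ _ := injHullNorm β E
  eq_zero_of_norm_eq_zero E _ _ _ z hz :=
    symMap_injective (dualEmbedding 𝕜 E).injective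
      ((β.eq_zero_of_norm_eq_zero _ _ hz).trans (map_zero _).symm)
  eps_le E _ _ _ z := (epsNorm_le_epsNorm_symMap (dualEmbedding 𝕜 E) z).trans (β.eps_le _ _)
  le_pi E _ _ _ z := (β.le_pi _ _).trans (piNorm_symMap_le
    (dualEmbedding 𝕜 E).toContinuousLinearMap (dualEmbedding 𝕜 E).norm_toContinuousLinearMap_le z)
  map_le E F _ _ _ _ _ _ T z := injHullNorm_map_le β T z
  finitelyGenerated E _ _ _ z := by
    obtain ⟨M, hM, w, hw⟩ := exists_finiteDimensional_symMap_subtype z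
    -- by injectivity all subspaces `M` carrying `z` give the same norm
    refine IsLeast.isGLB ⟨⟨M, hM, FiniteDimensional.complete 𝕜 M, w, hw, ?_⟩, ?_⟩
    · rw [← hw]
      exact injHullNorm_symMap_isometry β M.subtypeₗᵢ w
    · rintro _ ⟨M, _, _, w, rfl, rfl⟩
      exact (injHullNorm_symMap_isometry β M.subtypeₗᵢ w).le

theorem isInjectiveHull_injHull (β : STensorNorm.{u} 𝕜 n) : β.IsInjectiveHull (injHull β) := by
  refine ⟨⟨fun E F _ _ _ _ _ _ J z => injHullNorm_symMap_isometry β J z, fun E _ _ _ z => ?_⟩, ?_⟩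
  · exact β.norm_symMap_le_of_le_one (dualEmbedding 𝕜 E).toContinuousLinearMap
      (dualEmbedding 𝕜 E).norm_toContinuousLinearMap_le z
  · rintro δ ⟨hδ, hle⟩ E _ _ _ z
    rw [← hδ _ _ (dualEmbedding 𝕜 E) z]
    exact hle _ _

/-- A `β`-continuous polynomial composed with an operator which factors through `L_∞(μ)` (into the
bidual) is continuous for the injective hull of `β`. -/
theorem norm_functional_symMap_le_injHullNorm [CompleteSpace F] (β : STensorNorm.{u} 𝕜 n)
    (q : HomPoly 𝕜 n F) (C : ℝ≥0) (hq : ∀ z, ‖q.functional z‖ ≤ C * β.norm F z) {Ω : Type u}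
    [MeasurableSpace Ω] {μ : Measure Ω} (T : E →L[𝕜] F) (R : E →L[𝕜] Lp 𝕜 ⊤ μ)
    (S : Lp 𝕜 ⊤ μ →L[𝕜] StrongDual 𝕜 (StrongDual 𝕜 F))
    (hSR : ∀ x, S (R x) = NormedSpace.inclusionInDoubleDual 𝕜 F (T x)) (z : symTensor 𝕜 n E) :
    ‖q.functional (symMap n T.toLinearMap z)‖ ≤
      C * ((‖S‖ * ‖R‖) ^ n * injHullNorm β E z) := by
  have key := q.norm_functional_symMap_le T z
    (fun ε => C * (((‖S‖ + ε) * ‖R‖) ^ n * injHullNorm β E z)) (by fun_prop) ?_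
  · simpa using key
  intro k x ε hε
  obtain ⟨ι, _, P, V, hP, hV, hPV⟩ := exists_approx_lp_top μ (fun j => R (x j))
    (ε := ε / 2 / (‖S‖ + 1)) (by positivity)
  obtain ⟨S', hS'1, hS'2⟩ := exists_approx_factorization T R S hSR P V hV x hε hPV
  obtain ⟨A, hA1, hA2⟩ := exists_extension_pi (dualEmbedding 𝕜 E) (P.comp R)
  refine ⟨S'.comp (P.comp R), hS'2, (hq _).trans (mul_le_mul_of_nonneg_left ?_ C.2)⟩
  refine norm_symMap_le_injHullNorm β (S'.comp (P.comp R)) (S'.comp A)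
    (fun x => congrArg S' (hA1 x)) ?_ z
  refine (S'.opNorm_comp_le A).trans
    (mul_le_mul hS'1 (hA2.trans ?_) (norm_nonneg _) (by positivity))
  exact (P.opNorm_comp_le R).trans (mul_le_of_le_one_left (norm_nonneg _) hP)

theorem factorable_top_dualEmbedding_le [CompleteSpace E] :
    (OpClass.factorable.{u} 𝕜 ⊤).norm E (LInf 𝕜 (DualBall 𝕜 E))
      (dualEmbedding 𝕜 E).toContinuousLinearMap ≤ 1 := by
  refine le_trans (sInf_le ⟨DualBall 𝕜 E, inferInstance, Measure.count,
    (dualEmbedding 𝕜 E).toContinuousLinearMap, NormedSpace.inclusionInDoubleDual 𝕜 _,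
    fun x => rfl, rfl⟩) ?_
  refine mul_le_one' ?_ ?_
  · exact enorm_le_one_of_norm_le_one (NormedSpace.inclusionInDoubleDual_norm_le 𝕜 _)
  · exact enorm_le_one_of_norm_le_one (dualEmbedding 𝕜 E).norm_toContinuousLinearMap_le

theorem ofTensorNorm_injHull_isometricEq (β : STensorNorm.{u} 𝕜 n) :
    (PolyClass.ofTensorNorm (injHull β)).IsometricEq
      ((PolyClass.ofTensorNorm β).comp (OpClass.factorable.{u} 𝕜 ⊤)) := by
  intro E _ _ _ p
  suffices h : (PolyClass.ofTensorNorm (injHull β)).norm E p =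
      ((PolyClass.ofTensorNorm β).comp (OpClass.factorable.{u} 𝕜 ⊤)).norm E p by
    exact ⟨by rw [PolyClass.Mem, PolyClass.Mem, h], h⟩
  apply le_antisymm
  · refine le_sInf ?_
    rintro _ ⟨F, _, _, _, T, q, hT, hq, rfl, rfl⟩
    refine le_mul_sInf_pow hq.ne hT.ne ?_
    rintro _ ⟨Ω, _, μ, R, S, hSR, rfl⟩
    obtain ⟨C, hC⟩ : ∃ C : ℝ≥0, (C : ℝ≥0∞) = _ := ⟨_, ENNReal.coe_toNNReal hq.ne⟩
    have hCq := (ofTensorNorm_norm_le_iff β q C).1 hC.ge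
    rw [← hC]
    have hcoe : (C : ℝ≥0∞) * (‖S‖ₑ * ‖R‖ₑ) ^ n = ((C * (‖S‖₊ * ‖R‖₊) ^ n : ℝ≥0) : ℝ≥0∞) := by
      push_cast; rfl
    rw [hcoe, ofTensorNorm_norm_le_iff]
    intro z
    rw [HomPoly.functional_comp]
    refine (norm_functional_symMap_le_injHullNorm β q C hCq T R S hSR z).trans_eq ?_
    push_cast
    rw [mul_assoc]
    rfl
  · by_cases htop : (PolyClass.ofTensorNorm (injHull β)).norm E p = ∞
    · rw [htop]; exact le_top
    obtain ⟨C, hC⟩ : ∃ C : ℝ≥0, (C : ℝ≥0∞) = _ := ⟨_, ENNReal.coe_toNNReal htop⟩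
    have hCp := (ofTensorNorm_norm_le_iff _ p C).1 hC.ge
    obtain ⟨ψ, hψ1, hψ2⟩ := exists_extension_of_injective
      (symMap_injective (n := n) (dualEmbedding 𝕜 E).injective)
      (β.norm (LInf 𝕜 (DualBall 𝕜 E))) C p.functional hCp
    obtain ⟨q, rfl⟩ := β.exists_homPoly ψ C hψ2
    have hq : (PolyClass.ofTensorNorm β).norm _ q ≤ C := (ofTensorNorm_norm_le_iff _ q C).2 hψ2
    have hpq : p = q.comp (dualEmbedding 𝕜 E).toContinuousLinearMap := by
      apply Subtype.ext
      funext x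
      rw [← p.functional_symPow, ← hψ1, symMap_symPow, q.functional_symPow]
      rfl
    rw [← hC]
    refine le_trans (sInf_le ⟨_, _, _, inferInstance, (dualEmbedding 𝕜 E).toContinuousLinearMap, q,
      factorable_top_dualEmbedding_le.trans_lt ENNReal.one_lt_top,
      hq.trans_lt ENNReal.coe_lt_top, hpq, rfl⟩) ?_
    exact (mul_le_mul' hq (pow_le_one' factorable_top_dualEmbedding_le n)).trans_eq (mul_one _)

end InjectiveHull

/-! ### The spaces `ℓ_1` -/

section LOne

variable {𝕜 : Type} [RCLike 𝕜] {E F : Type u} [NormedAddCommGroup E] [NormedSpace 𝕜 E]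
  [NormedAddCommGroup F] [NormedSpace 𝕜 F] {ι : Type u} [Fintype ι]

variable (𝕜) in
/-- The space `ℓ_1^ι` for a finite index type `ι`. -/
abbrev LOne (ι : Type u) [Fintype ι] : Type u := PiLp 1 fun _ : ι => 𝕜

open Classical in
variable (𝕜) in
/-- The unit vectors of `ℓ_1^ι`. -/
def unitVec (i : ι) : LOne 𝕜 ι := PiLp.single 1 i (1 : 𝕜)

theorem unitVec_apply [DecidableEq ι] (i j : ι) : unitVec 𝕜 i j = if j = i then 1 else 0 := by
  rw [unitVec, PiLp.single_apply]
  congr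

theorem norm_unitVec (i : ι) : ‖unitVec 𝕜 i‖ = 1 := by
  classical
  rw [PiLp.norm_eq_of_L1, Finset.sum_eq_single i (fun j _ hj => by simp [unitVec_apply, hj])
    (by simp)]
  simp [unitVec_apply]

theorem sum_smul_unitVec (t : LOne 𝕜 ι) : ∑ i, t i • unitVec 𝕜 i = t := by
  classical
  ext j
  rw [WithLp.ofLp_sum, Finset.sum_apply, Finset.sum_eq_single j
    (fun i _ hi => by simp [unitVec_apply, Ne.symm hi]) (by simp)]
  simp [unitVec_apply]

theorem exists_clm_lone (x : ι → E) {C : ℝ} (hC : 0 ≤ C) (hx : ∀ i, ‖x i‖ ≤ C) :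
    ∃ V : LOne 𝕜 ι →L[𝕜] E, ‖V‖ ≤ C ∧ ∀ i, V (unitVec 𝕜 i) = x i := by
  classical
  obtain ⟨V, h1, h2⟩ := exists_clm_piLp_one (𝕜 := 𝕜) x hC hx
  refine ⟨V, h1, fun i => ?_⟩
  rw [h2, Finset.sum_eq_single i (fun j _ hj => by simp [unitVec_apply, hj]) (by simp)]
  simp [unitVec_apply]

theorem lone_hom_ext {V V' : LOne 𝕜 ι →ₗ[𝕜] E} (h : ∀ i, V (unitVec 𝕜 i) = V' (unitVec 𝕜 i)) :
    V = V' := by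
  ext t
  rw [← sum_smul_unitVec t]
  simp [h]

/-- The metric lifting property of `ℓ_1^ι`, up to `ε`. -/
theorem exists_lift_lone {Q : E →L[𝕜] F} (hQ : IsMetricSurjection Q) (V : LOne 𝕜 ι →L[𝕜] F)
    (hV : ‖V‖ ≤ 1) {K : ℝ} (hK : 1 < K) :
    ∃ V' : LOne 𝕜 ι →L[𝕜] E, ‖V'‖ ≤ K ∧ Q.toLinearMap ∘ₗ V'.toLinearMap = V.toLinearMap := by
  have hlift : ∀ i, ∃ x : E, Q x = V (unitVec 𝕜 i) ∧ ‖x‖ ≤ K := fun i => by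
    have h1 : ‖V (unitVec 𝕜 i)‖ ≤ 1 := by
      simpa [norm_unitVec] using V.le_of_opNorm_le hV (unitVec 𝕜 i)
    obtain ⟨_, ⟨x, hx, rfl⟩, hlt⟩ := (isGLB_lt_iff (hQ.2 _)).1 (h1.trans_lt hK)
    exact ⟨x, hx, hlt.le⟩
  choose x hx1 hx2 using hlift
  obtain ⟨V', h1, h2⟩ := exists_clm_lone (𝕜 := 𝕜) x (zero_le_one.trans hK.le) hx2
  exact ⟨V', h1, lone_hom_ext fun i => by simp [h2, hx1]⟩

/-- Operators of norm at most one on `ℓ_1^ι` have norm at most one in `𝓛_1`. -/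
theorem factorable_one_le_one [CompleteSpace E] (V : LOne 𝕜 ι →L[𝕜] E) (hV : ‖V‖ ≤ 1) :
    (OpClass.factorable.{u} 𝕜 1).norm (LOne 𝕜 ι) E V ≤ 1 := by
  classical
  let _ : MeasurableSpace ι := ⊤
  have : DiscreteMeasurableSpace ι := ⟨fun _ => trivial⟩
  let ν : Measure ι := Measure.count
  have hfin : ∀ i, ν {i} ≠ ∞ := fun i => by simp [ν]
  let ind : ι → Lp 𝕜 1 ν := fun i =>
    indicatorConstLp 1 (measurableSet_singleton i) (hfin i) (1 : 𝕜)
  have hind : ∀ i, ‖ind i‖ ≤ 1 := fun i => by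
    simp [ind, norm_indicatorConstLp, ν, Measure.real]
  have hind2 : ∀ i j, ind i j = if j = i then 1 else 0 := fun i j => by
    have := Measure.ae_count_iff.1 (indicatorConstLp_coeFn (p := 1)
      (hs := measurableSet_singleton i) (hμs := hfin i) (c := (1 : 𝕜))) j
    rw [this, Set.indicator_apply]
    simp
  have hnorm : ∀ f : Lp 𝕜 1 ν, ‖f‖ = ∑ i, ‖f i‖ := fun f => by
    rw [norm_lp_one_eq, integral_countable (L1.integrable_coeFn f).norm, tsum_fintype]
    simp [ν, Measure.real]
  obtain ⟨R, hR1, hR2⟩ := exists_clm_piLp_one (𝕜 := 𝕜) ind zero_le_one hind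
  let SL : Lp 𝕜 1 ν →ₗ[𝕜] E :=
    { toFun := fun f => ∑ i, f i • V (unitVec 𝕜 i)
      map_add' := fun f g => by
        rw [← Finset.sum_add_distrib]
        exact Finset.sum_congr rfl fun i _ => by
          rw [Measure.ae_count_iff.1 (Lp.coeFn_add f g) i, Pi.add_apply, add_smul]
      map_smul' := fun c f => by
        rw [RingHom.id_apply, Finset.smul_sum]
        exact Finset.sum_congr rfl fun i _ => by
          rw [Measure.ae_count_iff.1 (Lp.coeFn_smul c f) i, Pi.smul_apply, smul_assoc] }
  have hSL : ∀ f, ‖SL f‖ ≤ 1 * ‖f‖ := fun f => by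
    rw [one_mul, hnorm]
    refine (norm_sum_le _ _).trans (Finset.sum_le_sum fun i _ => ?_)
    rw [norm_smul]
    refine mul_le_of_le_one_right (norm_nonneg _) ?_
    simpa [norm_unitVec] using V.le_of_opNorm_le hV (unitVec 𝕜 i)
  have hSR : ∀ t, SL (R t) = V t := by
    intro t
    have h1 : ∀ i, SL (ind i) = V (unitVec 𝕜 i) := fun i => by
      have : SL (ind i) = ∑ j, ind i j • V (unitVec 𝕜 j) := rfl
      rw [this, Finset.sum_eq_single i (fun j _ hj => by rw [hind2, if_neg hj, zero_smul])
        (by simp), hind2, if_pos rfl, one_smul]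
    rw [hR2, map_sum]
    conv_rhs => rw [← sum_smul_unitVec t, map_sum]
    exact Finset.sum_congr rfl fun i _ => by rw [map_smul, map_smul, h1]
  let J := NormedSpace.inclusionInDoubleDual 𝕜 E
  refine le_trans (sInf_le ⟨ι, inferInstance, ν, R, J.comp (SL.mkContinuous 1 hSL),
    fun t => congrArg J (hSR t), rfl⟩) ?_
  refine mul_le_one' (enorm_le_one_of_norm_le_one ?_) (enorm_le_one_of_norm_le_one hR1)
  exact (J.opNorm_comp_le _).trans (mul_le_one₀ (NormedSpace.inclusionInDoubleDual_norm_le 𝕜 _)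
    (norm_nonneg _) (LinearMap.mkContinuous_norm_le _ zero_le_one _))

variable (𝕜 E) in
/-- Every Banach space is a metric quotient of the space `ℓ_1` over its unit ball. -/
theorem exists_isMetricSurjection_lp_one [CompleteSpace E] :
    ∃ Q : lp (fun _ : {x : E // ‖x‖ ≤ 1} => 𝕜) 1 →L[𝕜] E, IsMetricSurjection Q := by
  classical
  let S := {x : E // ‖x‖ ≤ 1}
  have hsum : ∀ f : lp (fun _ : S => 𝕜) 1, HasSum (fun s => ‖f s‖) ‖f‖ := fun f => by
    simpa using lp.hasSum_norm (p := 1) (by simp) f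
  have hle : ∀ (f : lp (fun _ : S => 𝕜) 1) (s : S), ‖f s • s.1‖ ≤ ‖f s‖ := fun f s => by
    rw [norm_smul]
    exact mul_le_of_le_one_right (norm_nonneg _) s.2
  have hsm : ∀ f : lp (fun _ : S => 𝕜) 1, Summable fun s : S => f s • s.1 := fun f =>
    Summable.of_norm_bounded (hsum f).summable (hle f)
  let QL : lp (fun _ : S => 𝕜) 1 →ₗ[𝕜] E :=
    { toFun := fun f => ∑' s : S, f s • s.1
      map_add' := fun f g => by
        rw [← (hsm f).tsum_add (hsm g)]
        simp [add_smul]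
      map_smul' := fun c f => by
        rw [RingHom.id_apply, ← tsum_const_smul'']
        simp [mul_smul] }
  have hQL : ∀ f, ‖QL f‖ ≤ 1 * ‖f‖ := fun f => by
    rw [one_mul]
    exact tsum_of_norm_bounded (hsum f) (hle f)
  have hpre : ∀ x : E, ∃ f : lp (fun _ : S => 𝕜) 1, QL f = x ∧ ‖f‖ = ‖x‖ := by
    intro x
    let s : S := ⟨(‖x‖⁻¹ : 𝕜) • x, by
      rw [norm_smul, norm_inv, RCLike.norm_ofReal, abs_norm]
      exact inv_mul_le_one⟩
    refine ⟨lp.single (E := fun _ : S => 𝕜) 1 s (‖x‖ : 𝕜), ?_, ?_⟩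
    · have : QL (lp.single (E := fun _ : S => 𝕜) 1 s (‖x‖ : 𝕜)) =
          ∑' s' : S, (lp.single (E := fun _ : S => 𝕜) 1 s (‖x‖ : 𝕜)) s' • s'.1 := rfl
      rw [this, tsum_eq_single s fun s' hs' => by
        rw [lp.single_apply_ne _ _ _ hs', zero_smul], lp.single_apply_self]
      by_cases hx : x = 0
      · simp [hx]
      · exact smul_inv_smul₀ (by simpa using hx) x
    · rw [lp.norm_single zero_lt_one]
      simp
  refine ⟨QL.mkContinuous 1 hQL, fun x => (hpre x).imp fun f hf => hf.1, fun x => ?_⟩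
  obtain ⟨f, hf1, hf2⟩ := hpre x
  refine IsLeast.isGLB ⟨⟨f, hf1, hf2.symm⟩, ?_⟩
  rintro _ ⟨g, rfl, rfl⟩
  exact (hQL g).trans_eq (one_mul _)

end LOne

/-! ### The projective hull -/

section ProjectiveHull

variable {𝕜 : Type} [RCLike 𝕜] {n : ℕ} {E F : Type u} [NormedAddCommGroup E] [NormedSpace 𝕜 E]
  [NormedAddCommGroup F] [NormedSpace 𝕜 F]

/-- The infimum of `β(w; ℓ_1^ι)` over all representations `z = ⊗ⁿ V w` with a finite index type `ι`
and an operator `V : ℓ_1^ι → E` of norm at most one. -/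
def projHullFun (β : STensorNorm.{u} 𝕜 n) (z : symTensor 𝕜 n E) : ℝ :=
  sInf {r : ℝ | ∃ (ι : Type u) (_ : Fintype ι) (V : LOne 𝕜 ι →L[𝕜] E)
    (w : symTensor 𝕜 n (LOne 𝕜 ι)), ‖V‖ ≤ 1 ∧ symMap n V.toLinearMap w = z ∧
      r = β.norm (LOne 𝕜 ι) w}

variable (β : STensorNorm.{u} 𝕜 n)

theorem projHullFun_symMap_le_norm {ι : Type u} [Fintype ι] (V : LOne 𝕜 ι →L[𝕜] E) (hV : ‖V‖ ≤ 1)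
    (w : symTensor 𝕜 n (LOne 𝕜 ι)) :
    projHullFun β (symMap n V.toLinearMap w) ≤ β.norm (LOne 𝕜 ι) w :=
  csInf_le ⟨0, by rintro _ ⟨_, _, _, _, -, -, rfl⟩; exact apply_nonneg _ _⟩
    ⟨ι, _, V, w, hV, rfl, rfl⟩

/-- Every representation of `z` as a combination of powers comes from a representation over some
`ℓ_1^ι`. -/
theorem exists_lone_rep {m : ℕ} (c : Fin m → 𝕜) (x : Fin m → E) :
    ∃ (ι : Type u) (_ : Fintype ι) (V : LOne 𝕜 ι →L[𝕜] E) (w : symTensor 𝕜 n (LOne 𝕜 ι)),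
      ‖V‖ ≤ 1 ∧ symMap n V.toLinearMap w = ∑ j, c j • symPow 𝕜 n (x j) ∧
        β.norm (LOne 𝕜 ι) w ≤ ∑ j, ‖c j‖ * ‖x j‖ ^ n := by
  obtain ⟨V, h1, h2⟩ := exists_clm_lone (𝕜 := 𝕜) (ι := ULift.{u} (Fin m))
    (fun j => (‖x j.down‖⁻¹ : 𝕜) • x j.down) zero_le_one (fun j => by
      rw [norm_smul, norm_inv, RCLike.norm_ofReal, abs_norm]
      exact inv_mul_le_one)
  refine ⟨ULift.{u} (Fin m), inferInstance, V,
    ∑ j, c j • symPow 𝕜 n ((‖x j‖ : 𝕜) • unitVec 𝕜 (ULift.up j)), h1, ?_, ?_⟩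
  · rw [symMap_sum]
    refine Finset.sum_congr rfl fun j _ => ?_
    have : V.toLinearMap ((‖x j‖ : 𝕜) • unitVec 𝕜 (ULift.up j)) = x j := by
      rw [ContinuousLinearMap.coe_coe, map_smul, h2]
      by_cases hx : x j = 0
      · simp [hx]
      · exact smul_inv_smul₀ (by simpa using hx) (x j)
    rw [this]
  · refine (β.le_pi _ _).trans ((piNorm_sum_le _ _).trans_eq ?_)
    simp [norm_smul, norm_unitVec]

theorem le_mul_projHullFun {z : symTensor 𝕜 n E} {a C : ℝ}
    (h : ∀ (ι : Type u) [Fintype ι] (V : LOne 𝕜 ι →L[𝕜] E) (w : symTensor 𝕜 n (LOne 𝕜 ι)),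
      ‖V‖ ≤ 1 → symMap n V.toLinearMap w = z → a ≤ C * β.norm (LOne 𝕜 ι) w) (hC : 0 ≤ C) :
    a ≤ C * projHullFun β z := by
  have hlim : Tendsto (fun r : ℝ => C * r) (𝓝[>] (projHullFun β z)) (𝓝 (C * projHullFun β z)) :=
    ((continuous_const.mul continuous_id).tendsto _).mono_left nhdsWithin_le_nhds
  refine ge_of_tendsto hlim ?_
  filter_upwards [self_mem_nhdsWithin] with r hr
  obtain ⟨m, c, x, hz⟩ := exists_sum_symPow z
  obtain ⟨ι, _, V, w, h1, h2, -⟩ := exists_lone_rep (n := n) β c x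
  obtain ⟨_, ⟨ι, _, V, w, h1, h2, rfl⟩, hlt⟩ :=
    exists_lt_of_csInf_lt (by exact ⟨_, ι, inferInstance, V, w, h1, h2.trans hz.symm, rfl⟩)
      (show sInf _ < r from hr)
  exact (h ι V w h1 h2).trans (mul_le_mul_of_nonneg_left hlt.le hC)

theorem le_projHullFun {z : symTensor 𝕜 n E} {a : ℝ}
    (h : ∀ (ι : Type u) [Fintype ι] (V : LOne 𝕜 ι →L[𝕜] E) (w : symTensor 𝕜 n (LOne 𝕜 ι)),
      ‖V‖ ≤ 1 → symMap n V.toLinearMap w = z → a ≤ β.norm (LOne 𝕜 ι) w) :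
    a ≤ projHullFun β z := by
  rw [← one_mul (projHullFun β z)]
  exact le_mul_projHullFun β (by simpa using h) zero_le_one

theorem projHullFun_symMap_le {ι : Type u} [Fintype ι] (V : LOne 𝕜 ι →L[𝕜] E) {K : ℝ}
    (hK : 0 < K) (hV : ‖V‖ ≤ K) (w : symTensor 𝕜 n (LOne 𝕜 ι)) :
    projHullFun β (symMap n V.toLinearMap w) ≤ K ^ n * β.norm (LOne 𝕜 ι) w := by
  have hK' : (K : 𝕜) ≠ 0 := by exact_mod_cast hK.ne'
  have h1 : ‖(K : 𝕜)⁻¹ • V‖ ≤ 1 := by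
    rw [norm_smul, norm_inv, RCLike.norm_ofReal, abs_of_pos hK]
    exact inv_mul_le_one_of_le₀ hV hK.le
  have h2 : symMap n V.toLinearMap w = symMap n ((K : 𝕜)⁻¹ • V).toLinearMap ((K : 𝕜) ^ n • w) := by
    rw [ContinuousLinearMap.toLinearMap_smul, symMap_smul_apply, map_smul, smul_smul, ← mul_pow,
      inv_mul_cancel₀ hK', one_pow, one_smul]
  rw [h2]
  refine (projHullFun_symMap_le_norm β _ h1 _).trans_eq ?_
  rw [map_smul_eq_mul, norm_pow, RCLike.norm_ofReal, abs_of_pos hK]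

theorem projHullFun_map_le (T : E →L[𝕜] F) (z : symTensor 𝕜 n E) :
    projHullFun β (symMap n T.toLinearMap z) ≤ ‖T‖ ^ n * projHullFun β z := by
  have hlim : Tendsto (fun K : ℝ => K ^ n * projHullFun β z) (𝓝[>] ‖T‖)
      (𝓝 (‖T‖ ^ n * projHullFun β z)) :=
    (((continuous_id.pow n).mul continuous_const).tendsto _).mono_left nhdsWithin_le_nhds
  refine ge_of_tendsto hlim ?_
  filter_upwards [self_mem_nhdsWithin] with K hK
  have hK0 : 0 < K := (norm_nonneg T).trans_lt hK
  refine le_mul_projHullFun β (fun ι _ V w hV hw => ?_) (by positivity)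
  rw [← hw, symMap_comp_apply]
  refine projHullFun_symMap_le β (T.comp V) hK0 ?_ w
  exact (T.opNorm_comp_le V).trans ((mul_le_of_le_one_right (norm_nonneg _) hV).trans
    (le_of_lt hK))

theorem projHullFun_add_le (z₁ z₂ : symTensor 𝕜 n E) :
    projHullFun β (z₁ + z₂) ≤ projHullFun β z₁ + projHullFun β z₂ := by
  rw [← sub_le_iff_le_add]
  refine le_projHullFun β fun ι₁ _ V₁ w₁ hV₁ hw₁ => ?_
  rw [sub_le_comm]
  refine le_projHullFun β fun ι₂ _ V₂ w₂ hV₂ hw₂ => ?_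
  rw [sub_le_iff_le_add']
  have hone : ∀ {ι : Type u} [Fintype ι] (V : LOne 𝕜 ι →L[𝕜] E), ‖V‖ ≤ 1 →
      ∀ i, ‖V (unitVec 𝕜 i)‖ ≤ 1 := fun V hV i => by
    simpa [norm_unitVec] using V.le_of_opNorm_le hV (unitVec 𝕜 i)
  obtain ⟨V, hV1, hV2⟩ := exists_clm_lone (𝕜 := 𝕜)
    (Sum.elim (fun i => V₁ (unitVec 𝕜 i)) fun i => V₂ (unitVec 𝕜 i)) zero_le_one (by
      rintro (i | i)
      · exact hone V₁ hV₁ i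
      · exact hone V₂ hV₂ i)
  obtain ⟨A₁, hA₁, hA₁'⟩ := exists_clm_lone (𝕜 := 𝕜)
    (fun i : ι₁ => unitVec 𝕜 (Sum.inl i : ι₁ ⊕ ι₂)) zero_le_one fun i => (norm_unitVec _).le
  obtain ⟨A₂, hA₂, hA₂'⟩ := exists_clm_lone (𝕜 := 𝕜)
    (fun i : ι₂ => unitVec 𝕜 (Sum.inr i : ι₁ ⊕ ι₂)) zero_le_one fun i => (norm_unitVec _).le
  have h1 : V.toLinearMap ∘ₗ A₁.toLinearMap = V₁.toLinearMap :=
    lone_hom_ext fun i => by simp [hA₁', hV2]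
  have h2 : V.toLinearMap ∘ₗ A₂.toLinearMap = V₂.toLinearMap :=
    lone_hom_ext fun i => by simp [hA₂', hV2]
  have hz : symMap n V.toLinearMap (symMap n A₁.toLinearMap w₁ + symMap n A₂.toLinearMap w₂) =
      z₁ + z₂ := by
    rw [map_add, symMap_comp_apply, symMap_comp_apply, h1, h2, hw₁, hw₂]
  rw [← hz]
  refine (projHullFun_symMap_le_norm β V hV1 _).trans ((map_add_le_add _ _ _).trans ?_)
  exact add_le_add (β.norm_symMap_le_of_le_one A₁ hA₁ w₁) (β.norm_symMap_le_of_le_one A₂ hA₂ w₂)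

theorem norm_le_projHullFun [CompleteSpace E] (z : symTensor 𝕜 n E) :
    β.norm E z ≤ projHullFun β z := by
  refine le_projHullFun β fun ι _ V w hV hw => ?_
  rw [← hw]
  exact β.norm_symMap_le_of_le_one V hV w

/-- The projective hull of an s-tensor norm. -/
def projHull : STensorNorm.{u} 𝕜 n where
  norm E _ _ _ := Seminorm.ofSMulLE (projHullFun β)
    (by
      refine le_antisymm ?_ (le_projHullFun β fun ι _ V w _ _ => apply_nonneg _ w)
      have := projHullFun_symMap_le_norm β (0 : LOne 𝕜 PEmpty.{u + 1} →L[𝕜] E) (by simp) 0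
      simpa using this)
    (projHullFun_add_le β)
    (fun r z => le_mul_projHullFun β (fun ι _ V w hV hw => by
      rw [← hw, ← map_smul]
      exact (projHullFun_symMap_le_norm β V hV _).trans_eq (map_smul_eq_mul _ _ _))
      (norm_nonneg r))
  eq_zero_of_norm_eq_zero E _ _ _ z hz := β.eq_zero_of_norm_eq_zero E z
    (le_antisymm ((norm_le_projHullFun β z).trans hz.le) (apply_nonneg _ z))
  eps_le E _ _ _ z := (β.eps_le E z).trans (norm_le_projHullFun β z)
  le_pi E _ _ _ z := le_piNorm fun m c x hz => by
    obtain ⟨ι, _, V, w, hV, hw, hle⟩ := exists_lone_rep (n := n) β c x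
    rw [hz, ← hw]
    exact (projHullFun_symMap_le_norm β V hV w).trans hle
  map_le E F _ _ _ _ _ _ T z := projHullFun_map_le β T z
  finitelyGenerated E _ _ _ z := by
    constructor
    · rintro _ ⟨M, _, _, w, rfl, rfl⟩
      have h1 := projHullFun_map_le β M.subtypeL w
      refine h1.trans (mul_le_of_le_one_left ?_ (pow_le_one₀ (norm_nonneg _)
        M.norm_subtypeL_le))
      exact le_projHullFun β fun ι _ V w _ _ => apply_nonneg _ w
    · intro b hb
      refine le_projHullFun β fun ι _ V w hV hw => ?_
      -- a representation over `V : ℓ_1^ι → E` already takes place in the range of `V`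
      let M : Submodule 𝕜 E := LinearMap.range V.toLinearMap
      let V₀ : LOne 𝕜 ι →L[𝕜] M := V.codRestrict M fun t => ⟨t, rfl⟩
      have hV₀ : ‖V₀‖ ≤ 1 := ContinuousLinearMap.opNorm_le_bound _ zero_le_one fun t =>
        V.le_of_opNorm_le hV t
      have hM : FiniteDimensional 𝕜 M := inferInstance
      have hle := hb ⟨M, hM, FiniteDimensional.complete 𝕜 M, symMap n V₀.toLinearMap w, by
        rw [symMap_comp_apply, ← hw]
        rfl, rfl⟩
      exact hle.trans (projHullFun_symMap_le_norm β V₀ hV₀ w)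

theorem isProjective_projHull : (projHull β).IsProjective := by
  intro E F _ _ _ _ _ _ Q hQ
  have hQ1 : ‖Q‖ ≤ 1 := Q.opNorm_le_bound zero_le_one fun x => by
    rw [one_mul]; exact (hQ.2 (Q x)).1 ⟨x, rfl, rfl⟩
  refine ⟨symMap_surjective hQ.1, fun z => ⟨?_, fun b hb => ?_⟩⟩
  · rintro _ ⟨w, rfl, rfl⟩
    exact (projHull β).norm_symMap_le_of_le_one Q hQ1 w
  · refine le_projHullFun β fun ι _ V w hV hw => ?_
    have hlim : Tendsto (fun K : ℝ => K ^ n * β.norm (LOne 𝕜 ι) w) (𝓝[>] 1)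
        (𝓝 ((1 : ℝ) ^ n * β.norm (LOne 𝕜 ι) w)) :=
      (((continuous_id.pow n).mul continuous_const).tendsto _).mono_left nhdsWithin_le_nhds
    rw [one_pow, one_mul] at hlim
    refine ge_of_tendsto hlim ?_
    filter_upwards [self_mem_nhdsWithin] with K hK
    -- liftings along `Q` exist only up to a factor `K > 1`
    obtain ⟨V', h1, h2⟩ := exists_lift_lone hQ V hV hK
    refine (hb ⟨symMap n V'.toLinearMap w, ?_, rfl⟩).trans
      (projHullFun_symMap_le β V' (zero_lt_one.trans hK) h1 w)
    rw [symMap_comp_apply, h2, hw]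

/-- On the spaces `ℓ_1(S)` the projective hull of `β` is dominated by `β`. The inequality is tested
on a functional which norms the tensor; the polynomial of this functional is continuous, so that the
tensor may be truncated to finitely many coordinates. -/
theorem projHullFun_lp_one_le {S : Type u} (w : symTensor 𝕜 n (lp (fun _ : S => 𝕜) 1)) :
    projHullFun β w ≤ β.norm (lp (fun _ : S => 𝕜) 1) w := by
  obtain ⟨φ, hφ1, hφ2⟩ := exists_functional_eq_seminorm
    ((projHull β).norm (lp (fun _ : S => 𝕜) 1)) w
  obtain ⟨q, rfl⟩ := (projHull β).exists_homPoly φ 1 (by simpa using hφ2)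
  have key := q.norm_functional_symMap_le (ContinuousLinearMap.id 𝕜 _) w
    (fun _ => β.norm (lp (fun _ : S => 𝕜) 1) w) continuous_const ?_
  · rw [ContinuousLinearMap.coe_id, symMap_id_apply, hφ1, RCLike.norm_ofReal,
      abs_of_nonneg (apply_nonneg _ _)] at key
    exact key
  intro k x ε hε
  obtain ⟨ι, _, P, V, hP, hV, hPV⟩ := exists_approx_little_lp_one x hε
  refine ⟨V.comp P, hPV, (hφ2 _).trans ?_⟩
  have h1 : symMap n (V.comp P).toLinearMap w =
      symMap n V.toLinearMap (symMap n P.toLinearMap w) := (symMap_comp_apply _ _ _).symm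
  rw [h1]
  exact (projHullFun_symMap_le_norm β V hV _).trans (β.norm_symMap_le_of_le_one P hP w)

theorem isProjectiveHull_projHull : β.IsProjectiveHull (projHull β) := by
  refine ⟨⟨isProjective_projHull β, fun E _ _ _ z => norm_le_projHullFun β z⟩, ?_⟩
  rintro δ ⟨hδ, hle⟩ E _ _ _ z
  obtain ⟨Q, hQ⟩ := exists_isMetricSurjection_lp_one 𝕜 E
  have hQ1 : ‖Q‖ ≤ 1 := Q.opNorm_le_bound zero_le_one fun x => by
    rw [one_mul]; exact (hQ.2 (Q x)).1 ⟨x, rfl, rfl⟩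
  refine ((hδ _ _ Q hQ).2 z).2 ?_
  rintro _ ⟨w, rfl, rfl⟩
  exact ((projHull β).norm_symMap_le_of_le_one Q hQ1 w).trans
    ((projHullFun_lp_one_le β w).trans (hle _ w))

/-- A polynomial which is continuous for the projective hull of `β` is `β`-continuous after
composition with an operator which factors through `L_1(μ)` (into the bidual). -/
theorem norm_functional_symMap_le_of_projHull [CompleteSpace F] (p : HomPoly 𝕜 n E)
    (C : ℝ≥0) (hp : ∀ z, ‖p.functional z‖ ≤ C * projHullFun β z) {Ω : Type u}
    [MeasurableSpace Ω] {μ : Measure Ω} (T : F →L[𝕜] E) (R : F →L[𝕜] Lp 𝕜 1 μ)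
    (S : Lp 𝕜 1 μ →L[𝕜] StrongDual 𝕜 (StrongDual 𝕜 E))
    (hSR : ∀ x, S (R x) = NormedSpace.inclusionInDoubleDual 𝕜 E (T x)) (z : symTensor 𝕜 n F) :
    ‖p.functional (symMap n T.toLinearMap z)‖ ≤ C * ((‖S‖ * ‖R‖) ^ n * β.norm F z) := by
  have key := p.norm_functional_symMap_le T z
    (fun ε => C * (((‖S‖ + ε) * ‖R‖) ^ n * β.norm F z)) (by fun_prop) ?_
  · simpa using key
  intro k x ε hε
  obtain ⟨ι, _, P, V, hP, hV, hPV⟩ := exists_approx_lp_one μ (fun j => R (x j))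
    (ε := ε / 2 / (‖S‖ + 1)) (by positivity)
  obtain ⟨S', hS'1, hS'2⟩ := exists_approx_factorization T R S hSR P V hV x hε hPV
  refine ⟨S'.comp (P.comp R), hS'2, (hp _).trans (mul_le_mul_of_nonneg_left ?_ C.2)⟩
  have h1 : symMap n (S'.comp (P.comp R)).toLinearMap z =
      symMap n S'.toLinearMap (symMap n (P.comp R).toLinearMap z) :=
    (symMap_comp_apply _ _ _).symm
  rw [h1, mul_pow, mul_assoc]
  refine (projHullFun_symMap_le β S' (by positivity) hS'1 _).trans
    (mul_le_mul_of_nonneg_left (β.norm_symMap_le (P.comp R) ?_ z) (by positivity))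
  exact (P.opNorm_comp_le R).trans (mul_le_of_le_one_left (norm_nonneg _) hP)

theorem ofTensorNorm_projHull_isometricEq :
    (PolyClass.ofTensorNorm (projHull β)).IsometricEq
      ((PolyClass.ofTensorNorm β).compInv (OpClass.factorable.{u} 𝕜 1)) := by
  intro E _ _ _ p
  suffices h : (PolyClass.ofTensorNorm (projHull β)).norm E p =
      ((PolyClass.ofTensorNorm β).compInv (OpClass.factorable.{u} 𝕜 1)).norm E p by
    exact ⟨by rw [PolyClass.Mem, PolyClass.Mem, h], h⟩
  apply le_antisymm
  · by_cases htop : ((PolyClass.ofTensorNorm β).compInv (OpClass.factorable.{u} 𝕜 1)).norm E p = ∞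
    · rw [htop]; exact le_top
    obtain ⟨C, hC⟩ : ∃ C : ℝ≥0, (C : ℝ≥0∞) = _ := ⟨_, ENNReal.coe_toNNReal htop⟩
    rw [← hC, ofTensorNorm_norm_le_iff]
    refine fun z => le_mul_projHullFun β (fun ι _ V w hV hw => ?_) C.2
    have h1 : (PolyClass.ofTensorNorm β).norm (LOne 𝕜 ι) (p.comp V) ≤ C := by
      rw [hC]
      exact le_sSup ⟨_, _, _, inferInstance, V, factorable_one_le_one V hV, rfl⟩
    have h2 := (ofTensorNorm_norm_le_iff β _ C).1 h1 w
    rwa [HomPoly.functional_comp, hw] at h2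
  · refine sSup_le ?_
    rintro _ ⟨F, _, _, _, T, hT, rfl⟩
    by_cases htop : (PolyClass.ofTensorNorm (projHull β)).norm E p = ∞
    · rw [htop]; exact le_top
    obtain ⟨C, hC⟩ : ∃ C : ℝ≥0, (C : ℝ≥0∞) = _ := ⟨_, ENNReal.coe_toNNReal htop⟩
    have hCp := (ofTensorNorm_norm_le_iff _ p C).1 hC.ge
    rw [← hC]
    refine (le_mul_sInf_pow (n := n) ENNReal.coe_ne_top
      (hT.trans_lt ENNReal.one_lt_top).ne ?_).trans
      ((mul_le_mul' le_rfl (pow_le_one' hT n)).trans_eq (mul_one _))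
    rintro _ ⟨Ω, _, μ, R, S, hSR, rfl⟩
    have hcoe : (C : ℝ≥0∞) * (‖S‖ₑ * ‖R‖ₑ) ^ n = ((C * (‖S‖₊ * ‖R‖₊) ^ n : ℝ≥0) : ℝ≥0∞) := by
      push_cast; rfl
    rw [hcoe, ofTensorNorm_norm_le_iff]
    intro z
    rw [HomPoly.functional_comp]
    refine (norm_functional_symMap_le_of_projHull β p C hCp T R S hSR z).trans_eq ?_
    push_cast
    rw [mul_assoc]

end ProjectiveHull

end SymTensorNorms

end

theorem mainTheorem4 (𝕜 : Type) [RCLike 𝕜] (n : ℕ) (hn : 1 ≤ n)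
    (β : SymTensorNorms.STensorNorm.{u} 𝕜 n) :
    (∃ γ : SymTensorNorms.STensorNorm.{u} 𝕜 n, β.IsInjectiveHull γ ∧
      (SymTensorNorms.PolyClass.ofTensorNorm γ).IsometricEq
        ((SymTensorNorms.PolyClass.ofTensorNorm β).comp
          (SymTensorNorms.OpClass.factorable.{u} 𝕜 ⊤))) ∧
    (∃ γ : SymTensorNorms.STensorNorm.{u} 𝕜 n, β.IsProjectiveHull γ ∧
      (SymTensorNorms.PolyClass.ofTensorNorm γ).IsometricEq
        ((SymTensorNorms.PolyClass.ofTensorNorm β).compInv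
          (SymTensorNorms.OpClass.factorable.{u} 𝕜 1))) := by
  exact ⟨⟨SymTensorNorms.injHull β, SymTensorNorms.isInjectiveHull_injHull β,
      SymTensorNorms.ofTensorNorm_injHull_isometricEq β⟩,
    ⟨SymTensorNorms.projHull β, SymTensorNorms.isProjectiveHull_projHull β,
      SymTensorNorms.ofTensorNorm_projHull_isometricEq β⟩⟩
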